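/- Let $K$ be an algebraically closed field of characteristic $0$ and let $n\ge 0$, $N\ge n+2$. Let $B\subset\mathbb{G}(1,N)$ be an irreducible closed subvariety of dimension $n$ of the Grassmannian of lines in $\mathbb{P}^N=\mathbb{P}(V)$ (closed in the Plücker embedding), and suppose that the union of the lines belonging to $B$ is an algebraic variety $X\subset\mathbb{P}^N$ of dimension $n+1$. For a line $r=\mathbb{P}(\hat r)$ in $B$, regard the Zariski tangent space $T_rB$ as a subspace of $T_r\mathbb{G}(1,N)=\operatorname{Hom}(\hat r,V/\hat r)$. The characteristic map of $B$ relative to $r$, $$\chi(r):\ T_rB\otimes\mathcal{O}_r\longrightarrow \mathcal{N}_{r|\mathbb{P}^N}\cong (V/\hat r)\otimes\mathcal{O}_r(1),$$ is the map induced by the inclusion of $T_rB$ in the tangent spaces of $B\times\mathbb{P}^N$ followed by the projection to the normal spaces of the incidence correspondence $\{(s,x) : x\in s\}\subset B\times\mathbb{P}^N$; over $[v]\in r$ it is, up to sign, $\eta\mapsto\eta(v)$. The focal locus on $r$ is the closed subscheme of $r\cong\mathbb{P}^1$ where $\chi(r)$ does not have maximal rank, defined by the minors of $\chi(r)$ of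 order $\min\{\dim T_rB,\,N-1\}$. A property holds for the general $r\in B$ if it holds for all $r$ in some non-empty Zariski open subset of $B$. The tangent space to $X$ is constant along $r$ if the embedded tangent spaces $\mathbb{T}_xX$ at all the nonsingular points $x$ of $X$ lying on $r$ coincide. Then the following are equivalent: (i) for the general $r\in B$, the focal locus on $r$ consists of $n$ points counted with multiplicity, i.e. it is a finite scheme of length $n$; (ii) the tangent space to $X$ is constant along every line $r$ of $B$; (ii$'$) the tangent space to $X$ is constant along the general line $r$ of $B$. -/

import Mathlib

open scoped LinearAlgebra.Projectivization

noncomputable section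

namespace FocalLines

/-! ### Projective varieties -/

section Varieties

variable {K : Type*} [Field K] {σ : Type}

/-- The ideal `I(Z)` of a set `Z` of points of `ℙ(K^σ)`: all polynomials that vanish at every
vector representing a point of `Z`. -/
def idealOf (Z : Set (ℙ K (σ → K))) : Ideal (MvPolynomial σ K) where
  carrier := {F | ∀ (v : σ → K) (hv : v ≠ 0), Projectivization.mk K v hv ∈ Z →
    MvPolynomial.eval v F = 0}
  zero_mem' _ _ _ := map_zero _
  add_mem' hF hG v hv hZ := by rw [map_add, hF v hv hZ, hG v hv hZ, add_zero]
  smul_mem' c F hF v hv hZ := by rw [smul_eq_mul, map_mul, hF v hv hZ, mul_zero]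

/-- Zariski closed: the common zero set of a family of homogeneous polynomials. -/
def IsZariskiClosed (Z : Set (ℙ K (σ → K))) : Prop :=
  ∃ S : Set (MvPolynomial σ K), (∀ F ∈ S, ∃ d : ℕ, F.IsHomogeneous d) ∧
    ∀ x : ℙ K (σ → K), x ∈ Z ↔ ∀ F ∈ S, MvPolynomial.eval x.rep F = 0

/-- An (irreducible, closed) projective variety. -/
def IsProjectiveVariety (Z : Set (ℙ K (σ → K))) : Prop :=
  IsZariskiClosed Z ∧ (idealOf Z).IsPrime

/-- Transcendence degree of the homogeneous coordinate ring `K[x] / I(Z)`; for a variety `Z` this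
is the dimension of the affine cone over `Z`, that is `dim Z + 1`. -/
def coneDim (Z : Set (ℙ K (σ → K))) : Cardinal :=
  Algebra.trdeg K (MvPolynomial σ K ⧸ idealOf Z)

/-- The variety `Z` has dimension `d`. -/
def HasDim (Z : Set (ℙ K (σ → K))) (d : ℕ) : Prop :=
  coneDim Z = ((d + 1 : ℕ) : Cardinal)

/-- The differential of the polynomial `F` at `v`. -/
def polyDifferential [Fintype σ] (F : MvPolynomial σ K) (v : σ → K) : (σ → K) →ₗ[K] K :=
  ∑ i, MvPolynomial.eval v (MvPolynomial.pderiv i F) • LinearMap.proj i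

/-- The embedded tangent space to `Z` at `x`, as a linear subspace of `K^σ`: the vectors killed
by the differentials at `x` of all polynomials in `I(Z)`. -/
def embTangent [Fintype σ] (Z : Set (ℙ K (σ → K))) (x : ℙ K (σ → K)) : Submodule K (σ → K) :=
  ⨅ F ∈ idealOf Z, LinearMap.ker (polyDifferential F x.rep)

/-- `x` is a nonsingular point of `Z`: the embedded tangent space has the dimension of `Z`. -/
def IsNonsingularAt [Fintype σ] (Z : Set (ℙ K (σ → K))) (x : ℙ K (σ → K)) : Prop :=
  x ∈ Z ∧ (Module.finrank K (embTangent Z x) : Cardinal) = coneDim Z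

end Varieties

/-! ### The characteristic map -/

section Characteristic

variable {K V T : Type*} [Field K] [AddCommGroup V] [Module K V] [AddCommGroup T] [Module K T]
  {R : Submodule K V} (θ : T →ₗ[K] R →ₗ[K] V ⧸ R) (v : R)

/-- Let `T = T_r B` be the tangent space to a family `B` at `r`, let `R = r̂`, and let `θ` be the
inclusion of `T_r B` in `Hom(r̂, V / r̂)`. This is the tangent space at `(r, v)`, `v ∈ r̂`, to the incidence correspondence
`{(s, w) | w ∈ ŝ} ⊆ B × V`: the first-order deformation of `r̂` with direction `θ η` consists of the
vectors `a + ε b` with `a ∈ r̂` and `b ≡ θ η a` modulo `r̂`, so `(η, w)` is tangent if and only if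
`v + ε w` lies in it. -/
def incidenceTangent : Submodule K (T × V) :=
  LinearMap.ker (R.mkQ ∘ₗ LinearMap.snd K T V -
    LinearMap.applyₗ v ∘ₗ θ ∘ₗ LinearMap.fst K T V)

theorem mem_incidenceTangent (p : T × V) :
    p ∈ incidenceTangent θ v ↔ R.mkQ p.2 = θ p.1 v := by
  simp [incidenceTangent, sub_eq_zero]

/-- The normal space at `(r, v)` to the incidence correspondence inside `B × V`. -/
abbrev NormalSpace : Type _ := (T × V) ⧸ incidenceTangent θ v

/-- The map from the normal space `V / r̂` of `r̂` in `V` to the normal space of the incidence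
correspondence, induced by the inclusion of the fibre `{r} × V` in `B × V`. -/
def normalMap : (V ⧸ R) →ₗ[K] NormalSpace θ v :=
  R.liftQ ((incidenceTangent θ v).mkQ ∘ₗ LinearMap.inr K T V) <| by
    intro w hw
    rw [LinearMap.mem_ker, LinearMap.comp_apply, Submodule.mkQ_apply,
      Submodule.Quotient.mk_eq_zero, mem_incidenceTangent]
    simpa using hw

theorem normalMap_mkQ (w : V) :
    normalMap θ v (R.mkQ w) = (incidenceTangent θ v).mkQ (0, w) := rfl

theorem normalMap_bijective : Function.Bijective (normalMap θ v) := by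
  constructor
  · rw [← LinearMap.ker_eq_bot, LinearMap.ker_eq_bot']
    intro w hw
    obtain ⟨w, rfl⟩ := R.mkQ_surjective w
    rw [normalMap_mkQ, Submodule.mkQ_apply, Submodule.Quotient.mk_eq_zero,
      mem_incidenceTangent] at hw
    simpa using hw
  · intro y
    obtain ⟨⟨η, w⟩, rfl⟩ := (incidenceTangent θ v).mkQ_surjective y
    obtain ⟨u, hu⟩ := R.mkQ_surjective (θ η v)
    refine ⟨R.mkQ (w - u), ?_⟩
    rw [normalMap_mkQ, Submodule.mkQ_apply, Submodule.mkQ_apply, Submodule.Quotient.eq,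
      mem_incidenceTangent]
    simpa using hu

/-- The characteristic map of the family relative to `r`, at the point `v ∈ r̂`: the composite
`T_r B → T_{(r,v)}(B × V) → N_{(r,v)} ≃ V / r̂`. -/
def characteristicMap : T →ₗ[K] V ⧸ R :=
  (LinearEquiv.ofBijective (normalMap θ v) (normalMap_bijective θ v)).symm.toLinearMap ∘ₗ
    (incidenceTangent θ v).mkQ ∘ₗ LinearMap.inl K T V

/-- Up to sign, the characteristic map is the evaluation of homomorphisms; in particular it is
linear in `v`. -/
theorem characteristicMap_apply (η : T) :
    characteristicMap θ v η = -θ η v := by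
  obtain ⟨u, hu⟩ := R.mkQ_surjective (θ η v)
  rw [characteristicMap, LinearMap.comp_apply, LinearEquiv.coe_coe, LinearEquiv.symm_apply_eq,
    LinearEquiv.ofBijective_apply, ← hu, ← map_neg, normalMap_mkQ, LinearMap.comp_apply,
    Submodule.mkQ_apply, Submodule.mkQ_apply, Submodule.Quotient.eq, mem_incidenceTangent]
  simpa using hu

end Characteristic

/-! ### The Grassmannian of lines -/

section Grassmannian

variable (K : Type*) [Field K] (N : ℕ)

/-- The underlying vector space `V` of `ℙ^N = ℙ(V)`. -/
abbrev Vec : Type _ := Fin (N + 1) → K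

/-- Index set of the coordinates `p_{ij}` of the (redundant) Plücker space. -/
abbrev PlIdx : Type := Fin (N + 1) × Fin (N + 1)

/-- The Grassmannian `𝔾(1, N)`: lines in `ℙ^N`, i.e. two-dimensional subspaces of `V`. -/
abbrev Line : Type _ := {r : Submodule K (Vec K N) // Module.finrank K r = 2}

variable {K N}

/-- The exterior product `u ∧ v` as the antisymmetric matrix `(u_i v_j - u_j v_i)`. -/
def wedge : Vec K N →ₗ[K] Vec K N →ₗ[K] (PlIdx N → K) :=
  LinearMap.mk₂ K (fun u v p => u p.1 * v p.2 - u p.2 * v p.1)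
    (fun _ _ _ => by ext; simp; ring) (fun _ _ _ => by ext; simp; ring)
    (fun _ _ _ => by ext; simp; ring) (fun _ _ _ => by ext; simp; ring)

theorem wedge_apply (u v : Vec K N) (p : PlIdx N) :
    wedge u v p = u p.1 * v p.2 - u p.2 * v p.1 := rfl

/-- A chosen basis of the plane `r̂ ⊆ V` over the line `r`. -/
def lineBasis (r : Line K N) : Module.Basis (Fin 2) K r.1 :=
  have : Module.Finite K r.1 := Module.finite_of_finrank_pos (by rw [r.2]; norm_num)
  Module.finBasisOfFinrankEq K r.1 r.2

theorem wedge_lineBasis_ne_zero (r : Line K N) :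
    wedge (lineBasis r 0 : Vec K N) (lineBasis r 1 : Vec K N) ≠ 0 := by
  intro h
  have hli : LinearIndependent K ![lineBasis r 0, lineBasis r 1] := by
    convert (lineBasis r).linearIndependent using 1
    ext i
    fin_cases i <;> rfl
  have h0 : (lineBasis r 0 : Vec K N) ≠ 0 := by
    simpa using (lineBasis r).ne_zero 0
  obtain ⟨i, hi⟩ := Function.ne_iff.mp h0
  rw [LinearIndependent.pair_iff' ((lineBasis r).ne_zero 0)] at hli
  refine hli ((lineBasis r 1 : Vec K N) i / (lineBasis r 0 : Vec K N) i) ?_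
  ext j
  have hj := congrFun h (i, j)
  simp only [wedge_apply, Pi.zero_apply] at hj hi
  simp only [Submodule.coe_smul, Pi.smul_apply, smul_eq_mul]
  field_simp
  linear_combination -hj

/-- The Plücker embedding. -/
def pluecker (r : Line K N) : ℙ K (PlIdx N → K) :=
  Projectivization.mk K (wedge (lineBasis r 0 : Vec K N) (lineBasis r 1 : Vec K N))
    (wedge_lineBasis_ne_zero r)

/-- A property holds for the general element of `B`: it holds for all elements of `B` outside
a Zariski closed set that does not contain all of `B`. -/
def ForGeneral (B : Set (Line K N)) (P : Line K N → Prop) : Prop :=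
  ∃ C : Set (ℙ K (PlIdx N → K)), IsZariskiClosed C ∧ (∃ r ∈ B, pluecker r ∉ C) ∧
    ∀ r ∈ B, pluecker r ∉ C → P r

/-- The union in `ℙ^N` of the lines belonging to `B`. -/
def unionOfLines (B : Set (Line K N)) : Set (ℙ K (Vec K N)) :=
  {x | ∃ r ∈ B, x.submodule ≤ r.1}

/-! ### Tangent spaces to a family of lines -/

/-- The derivative at `t = 0` of `(b₀ + t A b₀) ∧ (b₁ + t A b₁)`, where `b₀, b₁` is the basis
of `r̂`, as a linear function of `A : r̂ → V`. -/
def plueckerDifferential (r : Line K N) : (r.1 →ₗ[K] Vec K N) →ₗ[K] (PlIdx N → K) :=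
  wedge (lineBasis r 0 : Vec K N) ∘ₗ LinearMap.applyₗ (lineBasis r 1) +
    wedge.flip (lineBasis r 1 : Vec K N) ∘ₗ LinearMap.applyₗ (lineBasis r 0)

/-- The Zariski tangent space `T_r B`, as a subspace of `T_r 𝔾(1, N) = Hom(r̂, V / r̂)`: the
classes of the `A : r̂ → V` for which the first-order deformation of `r` spanned by
`b₀ + ε A b₀` and `b₁ + ε A b₁` satisfies the equations of `B` to first order. -/
def tangentSpace (B : Set (Line K N)) (r : Line K N) :
    Submodule K (r.1 →ₗ[K] Vec K N ⧸ r.1) :=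
  ((embTangent (pluecker '' B) (pluecker r)).comap (plueckerDifferential r)).map
    (LinearMap.compRight K r.1.mkQ)

/-! ### The focal locus -/

/-- The maximal rank allowed to the characteristic map relative to `r` by the ranks of its source
and of its target. -/
def maxRank (B : Set (Line K N)) (r : Line K N) : ℕ :=
  min (Module.finrank K (tangentSpace B r)) (Module.finrank K (Vec K N ⧸ r.1))

/-- For `η ∈ T_r B` and a linear form `l` on `V / r̂`, the linear form `v ↦ l (χ(v) η)` on `r̂`,
written in the coordinates `x₀, x₁` of `v = x₀ b₀ + x₁ b₁`. -/
def characteristicEntry (B : Set (Line K N)) (r : Line K N)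
    (l : Module.Dual K (Vec K N ⧸ r.1)) (η : tangentSpace B r) : MvPolynomial (Fin 2) K :=
  ∑ k, MvPolynomial.C (l (characteristicMap (tangentSpace B r).subtype (lineBasis r k) η)) * MvPolynomial.X k

/-- The homogeneous ideal, in the coordinate ring `K[x₀, x₁]` of `r`, of the focal subscheme on
`r`. It is generated by the minors of order `maxRank` of the characteristic map, written without
a choice of bases of `T_r B` and of `V / r̂`. -/
def focalIdeal (B : Set (Line K N)) (r : Line K N) : Ideal (MvPolynomial (Fin 2) K) :=
  Ideal.span {F | ∃ (l : Fin (maxRank B r) → Module.Dual K (Vec K N ⧸ r.1))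
    (η : Fin (maxRank B r) → tangentSpace B r),
    F = (Matrix.of fun i j => characteristicEntry B r (l i) (η j)).det}

/-- The subscheme of `ℙ¹` defined by the homogeneous ideal `J ⊆ K[x₀, x₁]` is finite of length
`d`, i.e. consists of `d` points counted with multiplicity: its Hilbert polynomial is the
constant `d`. -/
def HasLength {K : Type*} [Field K] (J : Ideal (MvPolynomial (Fin 2) K)) (d : ℕ) : Prop :=
  ∀ᶠ e in Filter.atTop, Module.finrank K (MvPolynomial.homogeneousSubmodule (Fin 2) K e ⧸
    (J.restrictScalars K).comap (MvPolynomial.homogeneousSubmodule (Fin 2) K e).subtype) = d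

/-- The tangent space to `X` is constant along `r`: it is the same linear space at all the
nonsingular points of `X` that lie on `r`. -/
def ConstantTangentAlong (X : Set (ℙ K (Vec K N))) (r : Line K N) : Prop :=
  ∃ P : Submodule K (Vec K N), ∀ x : ℙ K (Vec K N), x.submodule ≤ r.1 →
    IsNonsingularAt X x → embTangent X x = P

end Grassmannian

end FocalLines

end

/-! For a line r of B and v in r̂, let φ_v : T_rB → V/r̂ be evaluation at v, which up to sign is the
characteristic map at v. The proof compares three things: the images of the φ_v, the tangent spaces
to the cone over X, and the n × n minors of the pencil v ↦ φ_v.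

The cone over X is dominated by the bilinear map (q, w) ↦ `act q w`, where a Plücker vector q of a
line is read as an antisymmetric matrix with column space r̂. In characteristic zero its
differential at a general point maps onto the tangent space of the image. Computed modulo r̂, the
image of this differential is that of φ_v, v = `act q w`. So, at the general point v of a general
line, the tangent space to the cone over X is the preimage of im φ_v. A dimension count then gives
dim T_rB = n and φ_v injective (`forGeneral_isGeneralLine`). Hence the tangent space is constant
along such a line exactly when im φ_v does not depend on the general v. These facts are proved at a
generic point with coordinates in a field, where tangent vectors are maps to dual numbers, and are
then specialised.

The rest is algebra of a pencil φ with an injective member φ_{x₀} of rank n. If every image lies in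
im φ_{x₀}, all n × n minors are constant multiples of a single nonzero binary form of degree n, and
the scheme has length n. Conversely, length n forces all minors to be multiples of one minor F with
F(x₀) = 1. Replacing one row of F by a functional f that kills im φ_{x₀} gives a multiple of F
vanishing at x₀, hence zero; Cramer's rule then shows that f kills every image
(`range_le_of_hasLength_pencilIdeal`).

To pass from the general line to every line (`coneTangent_le_of_forGeneral`), constancy is expressed
by an (n+2)-dimensional P contained in all the tangent spaces along the line. If two nonsingular
points of some line had different tangent spaces, too many equations of X would have independent
gradients at points of that line. Independence is an open condition, so it would persist on a nearby
line with such a P, and all the gradients would have to annihilate P. -/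

noncomputable section

namespace FocalLines

/-! ### First-order deformations over the dual numbers -/

section DualNumbers

open TrivSqZeroExt

/-- First-order Taylor expansion of a polynomial over the dual numbers. -/
theorem aeval_inl_add_inr {K E σ : Type*} [CommRing K] [CommRing E] [Algebra K E] [Fintype σ]
    (x y : σ → E) (F : MvPolynomial σ K) :
    MvPolynomial.aeval (fun i => (inl (x i) + inr (y i) : TrivSqZeroExt E E)) F =
      inl (MvPolynomial.aeval x F) +
        inr (∑ i, MvPolynomial.aeval x (MvPolynomial.pderiv i F) * y i) := by
  classical
  induction F using MvPolynomial.induction_on with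
  | C a =>
    simp [algebraMap_eq_inl']
  | add p q hp hq =>
    simp only [map_add, hp, hq, add_mul, Finset.sum_add_distrib, inl_add, inr_add]
    ring
  | mul_X p j hp =>
    rw [map_mul, hp, MvPolynomial.aeval_X]
    ext
    · simp
    · simp only [snd_mul, snd_add, snd_inl, snd_inr, fst_add, fst_inl, fst_inr, map_mul,
        MvPolynomial.aeval_X, Derivation.leibniz, MvPolynomial.pderiv_X, smul_eq_mul,
        map_add, zero_add, add_zero, MulOpposite.smul_eq_mul_unop, MulOpposite.unop_op, add_mul,
        Finset.sum_add_distrib]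
      congr 1
      · rw [Finset.sum_eq_single j] <;> simp +contextual [eq_comm]
      · rw [Finset.sum_mul]
        rw [zero_mul, zero_add]
        exact Finset.sum_congr rfl fun i _ => by ring

theorem snd_aeval_eq {K E σ : Type*} [CommRing K] [CommRing E] [Algebra K E] [Fintype σ]
    (z : σ → TrivSqZeroExt E E) (F : MvPolynomial σ K) :
    (MvPolynomial.aeval z F).snd =
      ∑ i, MvPolynomial.aeval (fun i => (z i).fst) (MvPolynomial.pderiv i F) * (z i).snd := by
  have h := aeval_inl_add_inr (K := K) (fun i => (z i).fst) (fun i => (z i).snd) F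
  simp only [inl_fst_add_inr_snd_eq] at h
  rw [h]
  simp

/-- This is the infinitesimal lifting property with `E` viewed as a `C`-algebra through `g`. The
ring homomorphism form avoids a clash with any algebra structure that `E` already carries. -/
theorem exists_ringHom_lift_of_formallySmooth {C L E : Type*} [CommRing C] [CommRing L]
    [CommRing E] [Algebra C L] [Algebra.FormallySmooth C L] (p : E →+* L)
    (hp : Function.Surjective p) (hk : IsNilpotent (RingHom.ker p)) (g : C →+* E)
    (hg : p.comp g = algebraMap C L) :
    ∃ h : L →+* E, p.comp h = RingHom.id L ∧ h.comp (algebraMap C L) = g := by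
  let _ : Algebra C E := g.toAlgebra
  let p' : E →ₐ[C] L := { p with commutes' := fun c => RingHom.congr_fun hg c }
  refine ⟨(Algebra.FormallySmooth.liftOfSurjective (AlgHom.id C L) p' hp hk : L →ₐ[C] E), ?_, ?_⟩
  · ext x
    exact Algebra.FormallySmooth.liftOfSurjective_apply (AlgHom.id C L) p' hp hk x
  · ext c
    exact (Algebra.FormallySmooth.liftOfSurjective (AlgHom.id C L) p' hp hk).commutes c

theorem isNilpotent_ker_fstHom (K L : Type*) [CommRing K] [CommRing L] [Algebra K L] :
    IsNilpotent (RingHom.ker (fstHom K L L : TrivSqZeroExt L L →+* L)) := by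
  refine ⟨2, ?_⟩
  rw [Submodule.pow_succ, Submodule.pow_one, Ideal.zero_eq_bot, eq_bot_iff]
  refine Ideal.mul_le.mpr ?_
  intro x hx y hy
  have hx : x.fst = 0 := hx
  have hy : y.fst = 0 := hy
  rw [Ideal.mem_bot]
  ext <;> simp [hx, hy]

open scoped IntermediateField.algebraAdjoinAdjoin in
/-- In characteristic zero a transcendence basis of a field can be moved in any first-order
direction. -/
theorem exists_deformation_of_isTranscendenceBasis {K L κ : Type*} [Field K] [Field L] [CharZero K]
    [Algebra K L] {s : κ → L} (hs : IsTranscendenceBasis K s) (c : κ → L) :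
    ∃ h : L →ₐ[K] TrivSqZeroExt L L, (∀ a, (h a).fst = a) ∧ ∀ i, (h (s i)).snd = c i := by
  let C := Algebra.adjoin K (Set.range s)
  let F := IntermediateField.adjoin K (Set.range s)
  have : CharZero F := charZero_of_injective_algebraMap (algebraMap K F).injective
  -- L is formally smooth over C = K[s]: L/K(s) is algebraic, so separable in characteristic zero,
  -- and K(s) is a localisation of K[s]. The prescribed deformation of the polynomial ring C
  -- therefore lifts to L.
  have : Algebra.IsAlgebraic F L := hs.isAlgebraic_field
  have h1 : Algebra.FormallySmooth F L :=
    have := Algebra.FormallyEtale.of_isSeparable F L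
    inferInstance
  have h2 : Algebra.FormallySmooth C F := .of_isLocalization (nonZeroDivisors _)
  have h3 : Algebra.FormallySmooth C L := .comp _ F _
  let g : C →ₐ[K] TrivSqZeroExt L L :=
    (MvPolynomial.aeval fun i => (inl (s i) + inr (c i))).comp hs.1.aevalEquiv.symm.toAlgHom
  have hg : ∀ i, g ⟨s i, Algebra.subset_adjoin ⟨i, rfl⟩⟩ = inl (s i) + inr (c i) := by
    intro i
    have : hs.1.aevalEquiv.symm ⟨s i, Algebra.subset_adjoin ⟨i, rfl⟩⟩ = MvPolynomial.X i := by
      rw [AlgEquiv.symm_apply_eq]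
      ext
      simp
    change MvPolynomial.aeval _ (hs.1.aevalEquiv.symm _) = _
    rw [this, MvPolynomial.aeval_X]
  have hfst : ((fstHom K L L).comp g) = C.val := by
    have : ((fstHom K L L).comp (MvPolynomial.aeval fun i => (inl (s i) + inr (c i)))) =
        C.val.comp hs.1.aevalEquiv.toAlgHom := by
      ext i
      have h1 : (fstHom K L L) (inl (s i) + inr (c i)) = s i := by
        change (inl (s i) + inr (c i) : TrivSqZeroExt L L).fst = s i
        simp
      have h2 : ((hs.1.aevalEquiv (MvPolynomial.X i) : C) : L) = s i := by simp
      rw [AlgHom.comp_apply, MvPolynomial.aeval_X]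
      exact h1.trans h2.symm
    rw [← AlgHom.comp_assoc, this]
    ext x
    simp
  obtain ⟨h, hh1, hh2⟩ := exists_ringHom_lift_of_formallySmooth
    (fstHom K L L : TrivSqZeroExt L L →+* L) fst_surjective (isNilpotent_ker_fstHom K L)
    (g : C →+* TrivSqZeroExt L L) (RingHom.ext fun x => AlgHom.congr_fun hfst x)
  refine ⟨{ h with commutes' := fun a => ?_ }, fun a => RingHom.congr_fun hh1 a, fun i => ?_⟩
  · have := RingHom.congr_fun hh2 (algebraMap K C a)
    simpa using this.trans (g.commutes a)
  · have := RingHom.congr_fun hh2 ⟨s i, Algebra.subset_adjoin ⟨i, rfl⟩⟩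
    have e : h (s i) = inl (s i) + inr (c i) := this.trans (hg i)
    change (h (s i)).snd = c i
    simp [e]

/-- The family is completed to a transcendence basis, whose additional elements are kept fixed to
first order. -/
theorem exists_deformation_of_algebraicIndependent {K L : Type*} {κ : Type*} [Field K] [Field L]
    [CharZero K] [Algebra K L] {s : κ → L} (hs : AlgebraicIndependent K s) (c : κ → L) :
    ∃ h : L →ₐ[K] TrivSqZeroExt L L, (∀ a, (h a).fst = a) ∧ ∀ i, (h (s i)).snd = c i := by
  obtain ⟨t, hst, ht⟩ := exists_isTranscendenceBasis_superset (s := Set.range s) hs.coe_range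
  classical
  have hinj := hs.injective
  obtain ⟨h, h1, h2⟩ := exists_deformation_of_isTranscendenceBasis ht
    (fun x => Function.extend s c 0 x)
  refine ⟨h, h1, fun i => ?_⟩
  rw [h2 ⟨s i, hst ⟨i, rfl⟩⟩]
  exact hinj.extend_apply c 0 i

/-- In characteristic zero a first-order deformation is determined by its values on a
transcendence basis. -/
theorem snd_eq_zero_of_isTranscendenceBasis {K A L ι : Type*} [Field K] [CharZero K] [CommRing A]
    [IsDomain A] [Field L] [Algebra K A] [Algebra K L] (f : A →ₐ[K] L)
    (hf : Function.Injective f) (h : A →ₐ[K] TrivSqZeroExt L L) (hfst : ∀ a, (h a).fst = f a)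
    {t : ι → A} (ht : IsTranscendenceBasis K t) (h0 : ∀ i, (h (t i)).snd = 0) (a : A) :
    (h a).snd = 0 := by
  classical
  let C := Algebra.adjoin K (Set.range t)
  have hC : ∀ c : C, h c = inl (f c) := by
    have : h.comp C.val = (inlAlgHom K L L).comp (f.comp C.val) := by
      refine AlgHom.adjoin_ext ?_
      rintro _ ⟨i, rfl⟩
      ext <;> simp [hfst, h0]
    exact fun c => AlgHom.congr_fun this c
  have halg := (ht.isAlgebraic.isAlgebraic a : IsAlgebraic C a)
  -- A relation P of least degree for `a` has P'(a) ≠ 0 in characteristic zero. Applying `h` to P(a)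
  -- = 0 then gives f(P'(a)) · (h a).snd = 0.
  have hex : ∃ d : ℕ, ∃ P : Polynomial C, P ≠ 0 ∧ P.natDegree = d ∧ Polynomial.aeval a P = 0 :=
    ⟨_, halg.choose, halg.choose_spec.1, rfl, halg.choose_spec.2⟩
  obtain ⟨P, hP0, hPd, hP⟩ := Nat.find_spec hex
  have hder : Polynomial.aeval a P.derivative ≠ 0 := by
    intro hz
    by_cases hd : P.natDegree = 0
    · rw [Polynomial.eq_C_of_natDegree_eq_zero hd, Polynomial.aeval_C] at hP
      have h00 : P.coeff 0 = 0 := by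
        apply Subtype.ext
        exact hP
      rw [Polynomial.eq_C_of_natDegree_eq_zero hd, h00] at hP0
      simp at hP0
    · have : CharZero C := charZero_of_injective_algebraMap (algebraMap K C).injective
      refine Nat.find_min hex (m := P.derivative.natDegree) ?_ ⟨P.derivative, ?_, rfl, hz⟩
      · rw [← hPd]
        exact Polynomial.natDegree_derivative_lt hd
      · intro h'
        exact hd (Polynomial.derivative_eq_zero.mp h')
  have key : h (Polynomial.aeval a P) =
      inl (f (Polynomial.aeval a P)) + inr (f (Polynomial.aeval a P.derivative) * (h a).snd) := by
    have ha : h a = inl (f a) + inr (h a).snd := by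
      rw [← hfst, inl_fst_add_inr_snd_eq]
    let _ : Algebra C L := (f.comp C.val).toRingHom.toAlgebra
    have e1 : ∀ Q : Polynomial C, f (Polynomial.aeval a Q) = Polynomial.aeval (f a) Q := by
      intro Q
      simp only [Polynomial.aeval_def, Polynomial.hom_eval₂, ← AlgHom.coe_toRingHom]
      rfl
    have e2 : ∀ x : L, ∀ Q : Polynomial C,
        Polynomial.aeval (inl x : TrivSqZeroExt L L) Q = inl (Polynomial.aeval x Q) := by
      intro x Q
      exact Polynomial.aeval_algHom_apply (inlAlgHom C L L) x Q
    have e3 : h (Polynomial.aeval a P) = Polynomial.aeval (h a) P := by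
      rw [Polynomial.aeval_def, Polynomial.aeval_def, ← AlgHom.coe_toRingHom, Polynomial.hom_eval₂]
      congr 1
      ext c : 1
      exact hC c
    rw [e3, ha, Polynomial.aeval_add_of_sq_eq_zero _ _ _ (by rw [pow_two, inr_mul_inr]), e2, e2,
      ← e1, ← e1]
    congr 1
    ext <;> simp [mul_comm]
  rw [hP] at key
  have := congrArg TrivSqZeroExt.snd key
  simp only [map_zero, inl_zero, zero_add, snd_inr, snd_zero] at this
  rcases mul_eq_zero.mp this.symm with h' | h'
  · exact absurd ((map_eq_zero_iff f hf).mp h') hder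
  · exact h'

end DualNumbers

/-! ### Orthogonal spaces and specialisation from the generic point -/

section Specialization

theorem finrank_ker_mulVecLin_of_linearIndependent {E m κ : Type*} [Field E] [Fintype m]
    [Fintype κ] {s : κ → m → E} (hs : LinearIndependent E s) :
    Module.finrank E (LinearMap.ker (Matrix.of s).mulVecLin) + Fintype.card κ =
      Fintype.card m := by
  have h1 := LinearMap.finrank_range_add_finrank_ker (Matrix.of s).mulVecLin
  have h2 : (Matrix.of s).rank = Fintype.card κ := LinearIndependent.rank_matrix hs
  rw [Matrix.rank] at h2
  rw [Module.finrank_fintype_fun_eq_card] at h1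
  omega

/-- The vectors orthogonal to all elements of `S`. -/
def orth {E m : Type*} [Field E] [Fintype m] (S : Set (m → E)) : Submodule E (m → E) where
  carrier := {x | ∀ s ∈ S, s ⬝ᵥ x = 0}
  zero_mem' s _ := dotProduct_zero s
  add_mem' hx hy s hs := by rw [dotProduct_add, hx s hs, hy s hs, add_zero]
  smul_mem' c x hx s hs := by rw [dotProduct_smul, hx s hs, smul_zero]

theorem mem_orth {E m : Type*} [Field E] [Fintype m] {S : Set (m → E)} {x : m → E} :
    x ∈ orth S ↔ ∀ s ∈ S, s ⬝ᵥ x = 0 := Iff.rfl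

theorem orth_anti {E m : Type*} [Field E] [Fintype m] {S T : Set (m → E)} (h : S ⊆ T) :
    orth T ≤ orth S := fun _ hx s hs => hx s (h hs)

theorem ker_mulVecLin_eq_orth {E m κ : Type*} [Field E] [Fintype m] (s : κ → m → E) :
    LinearMap.ker (Matrix.of s).mulVecLin = orth (Set.range s) := by
  ext x
  rw [LinearMap.mem_ker, mem_orth, Set.forall_mem_range, funext_iff]
  rfl

/-- A maximal independent subset of `S` imposes the same conditions as `S`. It serves to replace the
gradients of a whole ideal by finitely many independent ones. -/
theorem exists_linearIndependent_orth {E m : Type*} [Field E] [Fintype m] (S : Set (m → E)) :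
    ∃ (k : ℕ) (s : Fin k → m → E), (∀ i, s i ∈ S) ∧ LinearIndependent E s ∧
      Module.finrank E (orth S) + k = Fintype.card m := by
  obtain ⟨b, hbS, hspan, hli⟩ := exists_linearIndependent E S
  have hfin : Finite b := hli.finite
  have := Fintype.ofFinite b
  let e := (Fintype.equivFin b).symm
  refine ⟨Fintype.card b, fun i => (e i : m → E), fun i => hbS (e i).2,
    hli.comp e e.injective, ?_⟩
  have h := finrank_ker_mulVecLin_of_linearIndependent hli
  rw [ker_mulVecLin_eq_orth] at h
  have h' : orth S = orth (Set.range (fun x : b => (x : m → E))) := by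
    refine le_antisymm (orth_anti ?_) fun x hx s hs => ?_
    · rintro _ ⟨x, rfl⟩
      exact hbS x.2
    · have : s ∈ Submodule.span E b := hspan ▸ Submodule.subset_span hs
      refine Submodule.span_induction (p := fun s _ => s ⬝ᵥ x = 0) (fun s hs => hx s ⟨⟨s, hs⟩, rfl⟩)
        (zero_dotProduct x) (fun y z _ _ hy hz => ?_) (fun c y _ hy => ?_) this
      · rw [add_dotProduct, hy, hz, add_zero]
      · rw [smul_dotProduct, hy, smul_zero]
  rw [h']
  exact h

variable {R : Type*} [CommRing R] [IsDomain R] (L E : Type*) [Field L] [Field E]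
  [Algebra R L] [IsFractionRing R L] {m κ : Type*} [Fintype m]

/-- Vectors that are independent at the generic point are independent at the general point. -/
theorem exists_linearIndependent_specialization [Fintype κ] (s : κ → m → R)
    (hs : LinearIndependent L fun k i => algebraMap R L (s k i)) :
    ∃ g : R, g ≠ 0 ∧ ∀ f : R →+* E, f g ≠ 0 →
      LinearIndependent E fun k i => f (s k i) := by
  classical
  -- With its denominators cleared, the left inverse gives a matrix H over R for which s · H is b
  -- times the identity. This identity survives every f with f b ≠ 0, so g = b works.
  obtain ⟨l, hl⟩ := LinearMap.exists_leftInverse_of_injective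
    (Fintype.linearCombination L fun k i => algebraMap R L (s k i))
    (LinearMap.ker_eq_bot.mpr (linearIndependent_iff_injective_fintypeLinearCombination.mp hs))
  obtain ⟨b, hb⟩ := IsLocalization.exist_integer_multiples_of_finite (nonZeroDivisors R)
    (fun x : κ × m => l (Pi.single x.2 1) x.1)
  choose H hH using hb
  have key : ∀ k k', ∑ i, s k' i * H (k, i) = if k = k' then (b : R) else 0 := by
    intro k k'
    apply IsFractionRing.injective R L
    have h1 := congrFun (LinearMap.congr_fun hl (Pi.single k' 1)) k
    rw [LinearMap.comp_apply, Fintype.linearCombination_apply_single, one_smul,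
      LinearMap.id_apply, pi_eq_sum_univ' (fun i => algebraMap R L (s k' i)), map_sum] at h1
    simp only [map_smul, Finset.sum_apply, Pi.smul_apply, smul_eq_mul] at h1
    simp only [map_sum, map_mul, hH, Algebra.smul_def]
    have h2 : (algebraMap R L (b : R)) * (Pi.single k' 1 : κ → L) k =
        algebraMap R L (if k = k' then (b : R) else 0) := by
      by_cases h : k = k' <;> simp [h]
    rw [← h2, ← h1, Finset.mul_sum]
    exact Finset.sum_congr rfl fun i _ => by
      rw [mul_left_comm]
  refine ⟨b, nonZeroDivisors.coe_ne_zero b, fun f hf => ?_⟩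
  rw [Fintype.linearIndependent_iff]
  intro c hc k
  have h1 : ∑ i, (∑ k', c k' • (fun i => f (s k' i))) i * f (H (k, i)) = 0 := by
    rw [hc]
    simp
  simp only [Finset.sum_apply, Pi.smul_apply, smul_eq_mul, Finset.sum_mul] at h1
  rw [Finset.sum_comm] at h1
  simp only [mul_assoc, ← Finset.mul_sum, ← map_mul, ← map_sum, key] at h1
  simp only [apply_ite f, map_zero, mul_ite, mul_zero, Finset.sum_ite_eq, Finset.mem_univ,
    if_true] at h1
  exact (mul_eq_zero.mp h1).resolve_right hf

/-- The dimension of the orthogonal space at the general point is at most its dimension at the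
generic point. -/
theorem exists_finrank_orth_specialization_le (S : Set (m → R)) (d : ℕ)
    (hd : Module.finrank L (orth ((fun s i => algebraMap R L (s i)) '' S)) ≤ d) :
    ∃ g : R, g ≠ 0 ∧ ∀ f : R →+* E, f g ≠ 0 →
      Module.finrank E (orth ((fun s i => f (s i)) '' S)) ≤ d := by
  obtain ⟨k, s, hsS, hs, hk⟩ :=
    exists_linearIndependent_orth ((fun s i => algebraMap R L (s i)) '' S)
  choose s' hs' hss using hsS
  have hs2 : LinearIndependent L fun k i => algebraMap R L (s' k i) := by
    convert hs using 2 with k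
    exact hss k
  obtain ⟨g, hg, h⟩ := exists_linearIndependent_specialization L E s' hs2
  refine ⟨g, hg, fun f hf => ?_⟩
  have h1 := finrank_ker_mulVecLin_of_linearIndependent (h f hf)
  rw [ker_mulVecLin_eq_orth] at h1
  have h2 : orth ((fun s i => f (s i)) '' S) ≤ orth (Set.range fun k i => f (s' k i)) := by
    refine orth_anti ?_
    rintro _ ⟨k, rfl⟩
    exact ⟨s' k, hs' k, rfl⟩
  have h3 := Submodule.finrank_mono h2
  simp only [Fintype.card_fin] at h1
  omega

end Specialization

end FocalLines

namespace FocalLines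

/-! ### Affine cones over projective sets and their tangent spaces -/

section Cones

open MvPolynomial

variable {K : Type*} [Field K] {σ : Type}

/-- The non-zero vectors representing the points of `Z`. -/
def coneOf (Z : Set (ℙ K (σ → K))) : Set (σ → K) :=
  {v | ∃ hv : v ≠ 0, Projectivization.mk K v hv ∈ Z}

theorem mem_idealOf {Z : Set (ℙ K (σ → K))} {F : MvPolynomial σ K} :
    F ∈ idealOf Z ↔ ∀ v ∈ coneOf Z, eval v F = 0 :=
  ⟨fun h v hv => h v hv.1 hv.2, fun h v hv hZ => h v ⟨hv, hZ⟩⟩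

theorem smul_mem_coneOf {Z : Set (ℙ K (σ → K))} {v : σ → K} (hv : v ∈ coneOf Z) {c : K}
    (hc : c ≠ 0) : c • v ∈ coneOf Z := by
  obtain ⟨hv0, hZ⟩ := hv
  refine ⟨smul_ne_zero hc hv0, ?_⟩
  convert hZ using 1
  rw [Projectivization.mk_eq_mk_iff']
  exact ⟨c, rfl⟩

theorem rep_mem_coneOf {Z : Set (ℙ K (σ → K))} {x : ℙ K (σ → K)} (hx : x ∈ Z) :
    x.rep ∈ coneOf Z :=
  ⟨x.rep_nonzero, by rwa [Projectivization.mk_rep]⟩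

theorem exists_eval_ne_zero_of_notMem_idealOf {Z : Set (ℙ K (σ → K))} {F : MvPolynomial σ K}
    (h : F ∉ idealOf Z) : ∃ v ∈ coneOf Z, eval v F ≠ 0 := by
  rw [mem_idealOf] at h
  push Not at h
  exact h

theorem eval_smul_of_isHomogeneous {F : MvPolynomial σ K} {d : ℕ} (hF : F.IsHomogeneous d)
    (c : K) (v : σ → K) : eval (c • v) F = c ^ d * eval v F := by
  rw [eval_eq, eval_eq, Finset.mul_sum]
  refine Finset.sum_congr rfl fun m hm => ?_
  simp only [Pi.smul_apply, smul_eq_mul, mul_pow, Finset.prod_mul_distrib, Finset.prod_pow_eq_pow_sum]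
  have := hF.degree_eq_sum_deg_support hm
  rw [this]
  ring

theorem eval_smul_eq_sum (F : MvPolynomial σ K) (c : K) (v : σ → K) :
    eval (c • v) F =
      ∑ d ∈ Finset.range (F.totalDegree + 1), c ^ d * eval v (homogeneousComponent d F) := by
  conv_lhs => rw [← sum_homogeneousComponent F]
  rw [map_sum]
  exact Finset.sum_congr rfl fun d _ =>
    eval_smul_of_isHomogeneous (homogeneousComponent_isHomogeneous d F) c v

/-- If some homogeneous component of `F` does not vanish at `v`, then `F` does not vanish at
some multiple of `v`. -/
theorem exists_eval_smul_ne_zero [Infinite K] {F : MvPolynomial σ K} {v : σ → K} {d : ℕ}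
    (h : eval v (homogeneousComponent d F) ≠ 0) : ∃ c : K, c ≠ 0 ∧ eval (c • v) F ≠ 0 := by
  let P : Polynomial K := ∑ d ∈ Finset.range (F.totalDegree + 1),
    Polynomial.monomial d (eval v (homogeneousComponent d F))
  have hP : P ≠ 0 := by
    intro h0
    have h1 := congrArg (fun Q => Polynomial.coeff Q d) h0
    simp only [P, Polynomial.finsetSum_coeff, Polynomial.coeff_monomial, Finset.sum_ite_eq',
      Polynomial.coeff_zero, Finset.mem_range] at h1
    split_ifs at h1 with h2
    · exact h h1
    · exact h (by rw [homogeneousComponent_eq_zero _ _ (by omega), map_zero])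
  -- The factor X forces the chosen scalar to be nonzero.
  have hXP : Polynomial.X * P ≠ 0 := mul_ne_zero Polynomial.X_ne_zero hP
  obtain ⟨c, hc⟩ : ∃ c, Polynomial.eval c (Polynomial.X * P) ≠ 0 := by
    by_contra! hall
    exact hXP (Polynomial.funext fun c => by rw [hall c, Polynomial.eval_zero])
  rw [Polynomial.eval_mul, Polynomial.eval_X] at hc
  refine ⟨c, left_ne_zero_of_mul hc, ?_⟩
  convert right_ne_zero_of_mul hc using 1
  rw [eval_smul_eq_sum, Polynomial.eval_finsetSum]
  exact Finset.sum_congr rfl fun d _ => by rw [Polynomial.eval_monomial, mul_comm]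

/-- The polynomial F(tv) in t vanishes at every t ≠ 0, and K is infinite. The extra factor X in the
proof takes care of t = 0, which does not correspond to a point of the cone. -/
theorem aeval_smul_eq_zero [Infinite K] {Z : Set (ℙ K (σ → K))} {v : σ → K} (hv : v ∈ coneOf Z)
    {F : MvPolynomial σ K} (hF : F ∈ idealOf Z) :
    aeval (fun i => Polynomial.C (v i) * Polynomial.X) F = 0 := by
  have h : Polynomial.X * aeval (fun i => Polynomial.C (v i) * Polynomial.X) F = 0 := by
    refine Polynomial.funext fun c => ?_
    rw [Polynomial.eval_mul, Polynomial.eval_X, Polynomial.eval_zero]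
    by_cases hc : c = 0
    · rw [hc, zero_mul]
    · have := mem_idealOf.mp hF _ (smul_mem_coneOf hv hc)
      rw [← Polynomial.coe_aeval_eq_eval, comp_aeval_apply]
      convert mul_zero c
      rw [← this, ← aeval_eq_eval]
      congr 2
      ext i
      simp only [Pi.smul_apply, smul_eq_mul, map_mul, Polynomial.aeval_C, Polynomial.aeval_X,
        Algebra.algebraMap_self, RingHom.id_apply]
      exact mul_comm _ _
  exact (mul_eq_zero.mp h).resolve_left Polynomial.X_ne_zero

variable [Fintype σ]

theorem polyDifferential_apply (F : MvPolynomial σ K) (v x : σ → K) :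
    polyDifferential F v x = ∑ i, eval v (pderiv i F) * x i := by
  simp [polyDifferential]

theorem snd_aeval_inl_add_inr (F : MvPolynomial σ K) (v x : σ → K) :
    (aeval (fun i => (TrivSqZeroExt.inl (v i) + TrivSqZeroExt.inr (x i) : TrivSqZeroExt K K))
      F).snd = polyDifferential F v x := by
  rw [aeval_inl_add_inr, polyDifferential_apply]
  simp [aeval_eq_eval]

/-- The tangent space at the vector `v` to the affine cone over `Z`. -/
def coneTangent (Z : Set (ℙ K (σ → K))) (v : σ → K) : Submodule K (σ → K) :=
  ⨅ F ∈ idealOf Z, LinearMap.ker (polyDifferential F v)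

theorem mem_coneTangent {Z : Set (ℙ K (σ → K))} {v x : σ → K} :
    x ∈ coneTangent Z v ↔ ∀ F ∈ idealOf Z, polyDifferential F v x = 0 := by
  simp [coneTangent]

theorem coneTangent_eq_orth (Z : Set (ℙ K (σ → K))) (v : σ → K) :
    coneTangent Z v = orth ((fun F i => eval v (pderiv i F)) '' (idealOf Z : Set _)) := by
  ext x
  simp only [mem_coneTangent, mem_orth, Set.forall_mem_image, SetLike.mem_coe,
    polyDifferential_apply]
  rfl

/-- Homotheties preserve the cone, so F(c ·) lies in the ideal whenever F does; its differential at
v is c times that of F at c v. -/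
theorem coneTangent_le_smul (Z : Set (ℙ K (σ → K))) (v : σ → K) {c : K} (hc : c ≠ 0) :
    coneTangent Z v ≤ coneTangent Z (c • v) := by
  intro x hx
  rw [mem_coneTangent] at hx ⊢
  intro F hF
  have hG : bind₁ (fun i => C c * X i) F ∈ idealOf Z := by
    rw [mem_idealOf] at hF ⊢
    intro w hw
    have := hF _ (smul_mem_coneOf hw hc)
    rw [← aeval_eq_eval] at this ⊢
    rw [aeval_bind₁]
    simpa [Pi.smul_def] using this
  have h := hx _ hG
  rw [← snd_aeval_inl_add_inr, aeval_bind₁] at h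
  have h2 : polyDifferential F (c • v) (c • x) = 0 := by
    rw [← snd_aeval_inl_add_inr, ← h]
    congr 3
    ext i <;> simp [TrivSqZeroExt.algebraMap_eq_inl']
  rw [map_smul, smul_eq_mul] at h2
  exact (mul_eq_zero.mp h2).resolve_left hc

theorem coneTangent_smul (Z : Set (ℙ K (σ → K))) (v : σ → K) {c : K} (hc : c ≠ 0) :
    coneTangent Z (c • v) = coneTangent Z v := by
  refine le_antisymm ?_ (coneTangent_le_smul Z v hc)
  have := coneTangent_le_smul Z (c • v) (inv_ne_zero hc)
  rwa [inv_smul_smul₀ hc] at this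

theorem embTangent_mk (Z : Set (ℙ K (σ → K))) (v : σ → K) (hv : v ≠ 0) :
    embTangent Z (Projectivization.mk K v hv) = coneTangent Z v := by
  obtain ⟨a, ha⟩ := Projectivization.exists_smul_eq_mk_rep K v hv
  change coneTangent Z (Projectivization.mk K v hv).rep = _
  rw [← ha]
  exact coneTangent_smul Z v a.ne_zero

/-- Euler's relation, without assuming that F is homogeneous: differentiate F(tv) = 0 at t = 1. -/
theorem self_mem_coneTangent [Infinite K] {Z : Set (ℙ K (σ → K))} {v : σ → K}
    (hv : v ∈ coneOf Z) : v ∈ coneTangent Z v := by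
  rw [mem_coneTangent]
  intro F hF
  have h := congrArg (Polynomial.aeval (TrivSqZeroExt.inl 1 + TrivSqZeroExt.inr 1 :
    TrivSqZeroExt K K)) (aeval_smul_eq_zero hv hF)
  rw [comp_aeval_apply, map_zero] at h
  rw [← snd_aeval_inl_add_inr]
  have h2 := congrArg TrivSqZeroExt.snd h
  rw [TrivSqZeroExt.snd_zero] at h2
  rw [← h2]
  congr 3
  ext i <;> simp [TrivSqZeroExt.algebraMap_eq_inl']

end Cones

/-! ### Properties of the general line -/

section General

open MvPolynomial

variable {K : Type*} [Field K] {N : ℕ} {B : Set (Line K N)}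

theorem ForGeneral.mono {P Q : Line K N → Prop} (h : ForGeneral B P)
    (hPQ : ∀ r ∈ B, P r → Q r) : ForGeneral B Q := by
  obtain ⟨C, hC, hex, hP⟩ := h
  exact ⟨C, hC, hex, fun r hr hrC => hPQ r hr (hP r hr hrC)⟩

theorem forGeneral_of_forall (hB : B.Nonempty) {P : Line K N → Prop} (h : ∀ r ∈ B, P r) :
    ForGeneral B P := by
  obtain ⟨r, hr⟩ := hB
  refine ⟨∅, ⟨{1}, ?_, ?_⟩, ⟨r, hr, Set.notMem_empty _⟩, fun r hr _ => h r hr⟩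
  · rintro F rfl
    exact ⟨0, isHomogeneous_one _ _⟩
  · simp

theorem exists_pluecker_eq_mk {q : PlIdx N → K} (hq : q ∈ coneOf (pluecker '' B)) :
    ∃ r ∈ B, ∃ hq0 : q ≠ 0, pluecker r = Projectivization.mk K q hq0 := by
  obtain ⟨hq0, r, hr, he⟩ := hq
  exact ⟨r, hr, hq0, he⟩

/-- A general property holds at some line of `B` at which a given polynomial, not vanishing on
`B`, does not vanish. -/
theorem ForGeneral.exists_eval_ne_zero (hB : (idealOf (pluecker '' B)).IsPrime)
    {P : Line K N → Prop} (h : ForGeneral B P) {F : MvPolynomial (PlIdx N) K}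
    (hF : F ∉ idealOf (pluecker '' B)) :
    ∃ r ∈ B, P r ∧ ∃ (q : PlIdx N → K) (hq : q ≠ 0),
      pluecker r = Projectivization.mk K q hq ∧ eval q F ≠ 0 := by
  obtain ⟨C, ⟨S, hS, hC⟩, ⟨r, hr, hrC⟩, hP⟩ := h
  rw [hC] at hrC
  push Not at hrC
  obtain ⟨G, hGS, hG⟩ := hrC
  have hGI : G ∉ idealOf (pluecker '' B) := fun h =>
    hG (mem_idealOf.mp h _ (rep_mem_coneOf ⟨r, hr, rfl⟩))
  have hGF : G * F ∉ idealOf (pluecker '' B) := fun h =>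
    (hB.mem_or_mem h).elim hGI hF
  obtain ⟨q, hq, hne⟩ := exists_eval_ne_zero_of_notMem_idealOf hGF
  rw [map_mul] at hne
  obtain ⟨r', hr', hq0, he⟩ := exists_pluecker_eq_mk hq
  refine ⟨r', hr', hP r' hr' ?_, q, hq0, he, right_ne_zero_of_mul hne⟩
  rw [hC, he]
  push Not
  refine ⟨G, hGS, ?_⟩
  obtain ⟨d, hd⟩ := hS G hGS
  obtain ⟨a, ha⟩ := Projectivization.exists_smul_eq_mk_rep K q hq0
  rw [← ha]
  change eval ((a : K) • q) G ≠ 0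
  rw [eval_smul_of_isHomogeneous hd]
  exact mul_ne_zero (pow_ne_zero _ a.ne_zero) (left_ne_zero_of_mul hne)

/-- A polynomial that does not vanish on `B` does not vanish at the general line of `B`. -/
theorem forGeneral_eval_ne_zero [Infinite K] {F : MvPolynomial (PlIdx N) K}
    (hF : F ∉ idealOf (pluecker '' B)) :
    ForGeneral B fun r => ∃ (q : PlIdx N → K) (hq : q ≠ 0),
      pluecker r = Projectivization.mk K q hq ∧ eval q F ≠ 0 := by
  -- Closed sets are cut out by homogeneous polynomials, whereas F is arbitrary. The excluded set is
  -- therefore the common zero set of all the components of F; off it, F is nonzero at a suitable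
  -- multiple of the representative.
  refine ⟨{x | ∀ d, eval x.rep (homogeneousComponent d F) = 0},
    ⟨Set.range fun d => homogeneousComponent d F, ?_, ?_⟩, ?_, ?_⟩
  · rintro _ ⟨d, rfl⟩
    exact ⟨d, homogeneousComponent_isHomogeneous d F⟩
  · intro x
    simp
  · obtain ⟨q, hq, hne⟩ := exists_eval_ne_zero_of_notMem_idealOf hF
    obtain ⟨r, hr, hq0, he⟩ := exists_pluecker_eq_mk hq
    refine ⟨r, hr, fun hall => hne ?_⟩
    rw [Set.mem_ofPred_eq, he] at hall
    obtain ⟨a, ha⟩ := Projectivization.exists_smul_eq_mk_rep K q hq0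
    have hq' : q = (a : K)⁻¹ • (Projectivization.mk K q hq0).rep := by
      rw [← ha]
      exact (inv_smul_smul₀ a.ne_zero q).symm
    rw [hq', eval_smul_eq_sum]
    exact Finset.sum_eq_zero fun d _ => by rw [hall d, mul_zero]
  · intro r hr hrC
    simp only [Set.mem_ofPred_eq, not_forall] at hrC
    obtain ⟨d, hd⟩ := hrC
    obtain ⟨c, hc, hne⟩ := exists_eval_smul_ne_zero hd
    refine ⟨c • (pluecker r).rep, smul_ne_zero hc (Projectivization.rep_nonzero _), ?_, hne⟩
    conv_lhs => rw [← Projectivization.mk_rep (pluecker r)]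
    rw [Projectivization.mk_eq_mk_iff']
    exact ⟨c⁻¹, inv_smul_smul₀ hc _⟩

/-- Two nonempty open subsets of an irreducible variety meet: as the ideal is prime, the product of
two equations that do not vanish on B does not vanish on B. -/
theorem ForGeneral.and (hB : (idealOf (pluecker '' B)).IsPrime) {P Q : Line K N → Prop}
    (hP : ForGeneral B P) (hQ : ForGeneral B Q) : ForGeneral B fun r => P r ∧ Q r := by
  obtain ⟨C, ⟨S, hS, hC⟩, ⟨r, hr, hrC⟩, hPC⟩ := hP
  obtain ⟨D, ⟨T, hT, hD⟩, ⟨s, hs, hsD⟩, hQD⟩ := hQ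
  refine ⟨C ∪ D, ⟨Set.image2 (· * ·) S T, ?_, ?_⟩, ?_, fun t ht htCD =>
    ⟨hPC t ht fun h => htCD (Or.inl h), hQD t ht fun h => htCD (Or.inr h)⟩⟩
  · rintro _ ⟨F, hF, G, hG, rfl⟩
    obtain ⟨d, hd⟩ := hS F hF
    obtain ⟨e, he⟩ := hT G hG
    exact ⟨d + e, hd.mul he⟩
  · intro x
    rw [Set.mem_union, hC, hD, Set.forall_mem_image2]
    simp only [map_mul, mul_eq_zero]
    constructor
    · rintro (h | h) F hF G hG
      · exact Or.inl (h F hF)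
      · exact Or.inr (h G hG)
    · intro h
      by_contra! hcon
      obtain ⟨⟨F, hF, hF0⟩, G, hG, hG0⟩ := hcon
      exact (h F hF G hG).elim hF0 hG0
  · rw [hC] at hrC
    rw [hD] at hsD
    push Not at hrC hsD
    obtain ⟨F, hF, hF0⟩ := hrC
    obtain ⟨G, hG, hG0⟩ := hsD
    have hFG : F * G ∉ idealOf (pluecker '' B) := fun h =>
      (hB.mem_or_mem h).elim (fun h => hF0 (mem_idealOf.mp h _ (rep_mem_coneOf ⟨r, hr, rfl⟩)))
        fun h => hG0 (mem_idealOf.mp h _ (rep_mem_coneOf ⟨s, hs, rfl⟩))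
    obtain ⟨q, hq, hne⟩ := exists_eval_ne_zero_of_notMem_idealOf hFG
    obtain ⟨t, ht, hq0, he⟩ := exists_pluecker_eq_mk hq
    obtain ⟨a, ha⟩ := Projectivization.exists_smul_eq_mk_rep K q hq0
    obtain ⟨d, hd⟩ := hS F hF
    obtain ⟨e, he'⟩ := hT G hG
    rw [map_mul] at hne
    have h1 : eval (pluecker t).rep F ≠ 0 := by
      rw [he, ← ha]
      change eval ((a : K) • q) F ≠ 0
      rw [eval_smul_of_isHomogeneous hd]
      exact mul_ne_zero (pow_ne_zero _ a.ne_zero) (left_ne_zero_of_mul hne)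
    have h2 : eval (pluecker t).rep G ≠ 0 := by
      rw [he, ← ha]
      change eval ((a : K) • q) G ≠ 0
      rw [eval_smul_of_isHomogeneous he']
      exact mul_ne_zero (pow_ne_zero _ a.ne_zero) (right_ne_zero_of_mul hne)
    refine ⟨t, ht, ?_⟩
    rw [Set.mem_union, hC, hD]
    rintro (h | h)
    · exact h1 (h F hF)
    · exact h2 (h G hG)

end General

end FocalLines

namespace FocalLines

/-! ### Plücker vectors as matrices, and tangent vectors to a family of lines -/

section Pluecker

open MvPolynomial

variable {K : Type*} [Field K] {N : ℕ}

/-- The matrix-vector product, for a point of the Plücker space seen as a matrix. -/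
def act : (PlIdx N → K) →ₗ[K] Vec K N →ₗ[K] Vec K N :=
  LinearMap.mk₂ K (fun p w i => ∑ j, p (i, j) * w j)
    (fun _ _ _ => by ext; simp [add_mul, Finset.sum_add_distrib])
    (fun _ _ _ => by ext; simp [Finset.mul_sum, mul_assoc])
    (fun _ _ _ => by ext; simp [mul_add, Finset.sum_add_distrib])
    (fun _ _ _ => by ext; simp [Finset.mul_sum, mul_left_comm])

theorem act_apply (p : PlIdx N → K) (w : Vec K N) (i : Fin (N + 1)) :
    act p w i = ∑ j, p (i, j) * w j := rfl

theorem act_single (p : PlIdx N → K) (i j : Fin (N + 1)) :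
    act p (Pi.single j 1) i = p (i, j) := by
  simp [act_apply, Pi.single_apply]

theorem act_wedge (u v w : Vec K N) :
    act (wedge u v) w = (v ⬝ᵥ w) • u - (u ⬝ᵥ w) • v := by
  ext i
  simp only [act_apply, wedge_apply, sub_mul, Finset.sum_sub_distrib, Pi.sub_apply, Pi.smul_apply,
    smul_eq_mul, dotProduct, Finset.sum_mul]
  congr 1 <;> exact Finset.sum_congr rfl fun j _ => by ring

/-- The Plücker vector of a line, computed in the chosen basis. -/
abbrev plueckerVec (r : Line K N) : PlIdx N → K :=
  wedge (lineBasis r 0 : Vec K N) (lineBasis r 1 : Vec K N)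

theorem plueckerVec_apply (r : Line K N) (p : PlIdx N) :
    plueckerVec r p = (lineBasis r 0 : Vec K N) p.1 * (lineBasis r 1 : Vec K N) p.2 -
      (lineBasis r 0 : Vec K N) p.2 * (lineBasis r 1 : Vec K N) p.1 := rfl

/-- The matrix u ∧ v has its columns in the span of u and v. Conversely, if p_ab ≠ 0, then p_ab u =
u_a p(·,b) − u_b p(·,a), and likewise for v, so both vectors are recovered. -/
theorem range_act_plueckerVec (r : Line K N) : LinearMap.range (act (plueckerVec r)) = r.1 := by
  apply le_antisymm
  · rintro _ ⟨w, rfl⟩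
    rw [act_wedge]
    exact sub_mem (r.1.smul_mem _ (lineBasis r 0).2) (r.1.smul_mem _ (lineBasis r 1).2)
  · obtain ⟨⟨a, b⟩, hab⟩ := Function.ne_iff.mp (wedge_lineBasis_ne_zero r)
    set c := plueckerVec r (a, b) with hc
    have hc0 : c ≠ 0 := hab
    have h0 : (lineBasis r 0 : Vec K N) ∈ LinearMap.range (act (plueckerVec r)) := by
      refine ⟨c⁻¹ • ((lineBasis r 0 : Vec K N) a • Pi.single b 1 -
        (lineBasis r 0 : Vec K N) b • Pi.single a 1), ?_⟩
      ext i
      rw [map_smul, map_sub, map_smul, map_smul]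
      simp only [Pi.smul_apply, Pi.sub_apply, act_single, smul_eq_mul, wedge_apply]
      rw [inv_mul_eq_iff_eq_mul₀ hc0, hc, plueckerVec_apply]
      ring
    have h1 : (lineBasis r 1 : Vec K N) ∈ LinearMap.range (act (plueckerVec r)) := by
      refine ⟨c⁻¹ • ((lineBasis r 1 : Vec K N) a • Pi.single b 1 -
        (lineBasis r 1 : Vec K N) b • Pi.single a 1), ?_⟩
      ext i
      rw [map_smul, map_sub, map_smul, map_smul]
      simp only [Pi.smul_apply, Pi.sub_apply, act_single, smul_eq_mul, wedge_apply]
      rw [inv_mul_eq_iff_eq_mul₀ hc0, hc, plueckerVec_apply]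
      ring
    intro v hv
    have hv' := (lineBasis r).sum_repr ⟨v, hv⟩
    rw [Fin.sum_univ_two] at hv'
    have hv2 := congrArg Subtype.val hv'
    simp only [Submodule.coe_add, Submodule.coe_smul] at hv2
    rw [← hv2]
    exact add_mem (Submodule.smul_mem _ _ h0) (Submodule.smul_mem _ _ h1)

theorem exists_eq_smul_plueckerVec {r : Line K N} {q : PlIdx N → K} {hq : q ≠ 0}
    (h : pluecker r = Projectivization.mk K q hq) : ∃ c : K, c ≠ 0 ∧ q = c • plueckerVec r := by
  rw [pluecker, eq_comm, Projectivization.mk_eq_mk_iff'] at h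
  obtain ⟨c, hc⟩ := h
  refine ⟨c, ?_, hc.symm⟩
  rintro rfl
  exact hq (by rw [← hc, zero_smul])

theorem range_act {r : Line K N} {q : PlIdx N → K} {hq : q ≠ 0}
    (h : pluecker r = Projectivization.mk K q hq) : LinearMap.range (act q) = r.1 := by
  obtain ⟨c, hc, rfl⟩ := exists_eq_smul_plueckerVec h
  rw [map_smul, LinearMap.range_smul _ _ hc, range_act_plueckerVec]

theorem act_mem {r : Line K N} {q : PlIdx N → K} {hq : q ≠ 0}
    (h : pluecker r = Projectivization.mk K q hq) (w : Vec K N) : act q w ∈ r.1 := by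
  rw [← range_act h]
  exact ⟨w, rfl⟩

theorem exists_wedge_of_mem_coneOf {B : Set (Line K N)} {q : PlIdx N → K}
    (hq : q ∈ coneOf (pluecker '' B)) : ∃ u v : Vec K N, q = wedge u v := by
  obtain ⟨r, -, hq0, h⟩ := exists_pluecker_eq_mk hq
  obtain ⟨c, -, rfl⟩ := exists_eq_smul_plueckerVec h
  exact ⟨c • (lineBasis r 0 : Vec K N), lineBasis r 1, by simp [plueckerVec]⟩

/-- The Plücker quadric vanishes on all decomposable vectors, hence on the cone over B; this is its
differential. -/
theorem coneTangent_pluecker_relation {B : Set (Line K N)} {p ξ : PlIdx N → K}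
    (hξ : ξ ∈ coneTangent (pluecker '' B) p) (i j a b : Fin (N + 1)) :
    ξ (i, j) * p (a, b) + p (i, j) * ξ (a, b) - ξ (i, a) * p (j, b) - p (i, a) * ξ (j, b) +
      ξ (i, b) * p (j, a) + p (i, b) * ξ (j, a) = 0 := by
  have hF : (X (i, j) * X (a, b) - X (i, a) * X (j, b) + X (i, b) * X (j, a) :
      MvPolynomial (PlIdx N) K) ∈ idealOf (pluecker '' B) := by
    rw [mem_idealOf]
    intro q hq
    obtain ⟨u, v, rfl⟩ := exists_wedge_of_mem_coneOf hq
    simp only [map_add, map_sub, map_mul, eval_X, wedge_apply]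
    ring
  have h := mem_coneTangent.mp hξ _ hF
  rw [← snd_aeval_inl_add_inr] at h
  simp only [map_add, map_sub, map_mul, aeval_X, TrivSqZeroExt.snd_add, TrivSqZeroExt.snd_sub,
    TrivSqZeroExt.snd_mul, TrivSqZeroExt.fst_add, TrivSqZeroExt.fst_inl, TrivSqZeroExt.fst_inr,
    TrivSqZeroExt.snd_inl, TrivSqZeroExt.snd_inr, smul_eq_mul, MulOpposite.smul_eq_mul_unop,
    MulOpposite.unop_op, zero_add, add_zero] at h
  linear_combination h

theorem plueckerDifferential_apply (r : Line K N) (A : r.1 →ₗ[K] Vec K N) :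
    plueckerDifferential r A =
      wedge (lineBasis r 0 : Vec K N) (A (lineBasis r 1)) +
        wedge (A (lineBasis r 0)) (lineBasis r 1 : Vec K N) := rfl

/-- The cone over a family of lines is tangent to the cone over the Grassmannian. -/
theorem exists_plueckerDifferential_eq {B : Set (Line K N)} {r : Line K N} {ξ : PlIdx N → K}
    (hξ : ξ ∈ coneTangent (pluecker '' B) (plueckerVec r)) :
    ∃ A, plueckerDifferential r A = ξ := by
  obtain ⟨⟨a, b⟩, hab⟩ := Function.ne_iff.mp (wedge_lineBasis_ne_zero r)
  have hc0 : plueckerVec r (a, b) ≠ 0 := hab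
  set u : Vec K N := ((lineBasis r 0 : r.1) : Vec K N) with hu
  set v : Vec K N := ((lineBasis r 1 : r.1) : Vec K N) with hv
  -- The images of u and v come from linearising p_ab u = u_a p(·,b) − u_b p(·,a) and its analogue
  -- for v, with the coefficients held fixed. The correction −ξ_ab u is made on one of the two
  -- vectors only; on both it would count the change of p_ab twice.
  refine ⟨(lineBasis r).constr K ![
    (plueckerVec r (a, b))⁻¹ • ((fun i => u a * ξ (i, b) - u b * ξ (i, a)) - ξ (a, b) • u),
    (plueckerVec r (a, b))⁻¹ • (fun i => v a * ξ (i, b) - v b * ξ (i, a))], ?_⟩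
  rw [plueckerDifferential_apply, Module.Basis.constr_basis, Module.Basis.constr_basis]
  ext ⟨i, j⟩
  have h := coneTangent_pluecker_relation hξ i j a b
  apply mul_left_cancel₀ hc0
  simp only [Matrix.cons_val_zero, Matrix.cons_val_one, map_smul, LinearMap.smul_apply,
    Pi.add_apply, Pi.smul_apply, smul_eq_mul, mul_add, mul_inv_cancel_left₀ hc0]
  simp only [wedge_apply, Pi.sub_apply, Pi.smul_apply, smul_eq_mul] at h ⊢
  linear_combination -h

/-- In the derivative of (v·w) u − (u·w) v, the terms that differentiate the coefficients stay in
r̂. Thus a tangent vector of the Plücker cone, applied to w, acts modulo r̂ as the homomorphism A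
applied to `act p w`. -/
theorem mkQ_act_plueckerDifferential (r : Line K N) (A : r.1 →ₗ[K] Vec K N) (w : Vec K N)
    (hw : act (plueckerVec r) w ∈ r.1) :
    r.1.mkQ (act (plueckerDifferential r A) w) = r.1.mkQ (A ⟨act (plueckerVec r) w, hw⟩) := by
  have h1 : (⟨act (plueckerVec r) w, hw⟩ : r.1) =
      ((lineBasis r 1 : Vec K N) ⬝ᵥ w) • lineBasis r 0 -
        ((lineBasis r 0 : Vec K N) ⬝ᵥ w) • lineBasis r 1 := by
    ext1
    simp [act_wedge]
  have h2 : ∀ i, r.1.mkQ (lineBasis r i : Vec K N) = 0 := fun i => by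
    rw [Submodule.mkQ_apply, Submodule.Quotient.mk_eq_zero]
    exact (lineBasis r i).2
  rw [h1, plueckerDifferential_apply, map_add, LinearMap.add_apply, act_wedge, act_wedge]
  simp only [map_add, map_sub, map_smul, h2, smul_zero]
  abel

theorem act_plueckerVec_mem (r : Line K N) (w : Vec K N) : act (plueckerVec r) w ∈ r.1 := by
  rw [← range_act_plueckerVec r]
  exact ⟨w, rfl⟩

/-- Every vector tangent to the cone over `B` induces an element of `T_r B`. -/
theorem exists_mem_tangentSpace {B : Set (Line K N)} {r : Line K N} {q : PlIdx N → K} {hq : q ≠ 0}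
    (h : pluecker r = Projectivization.mk K q hq) {ξ : PlIdx N → K}
    (hξ : ξ ∈ coneTangent (pluecker '' B) q) :
    ∃ θ ∈ tangentSpace B r, ∀ w, θ ⟨act q w, act_mem h w⟩ = r.1.mkQ (act ξ w) := by
  have hT : embTangent (pluecker '' B) (pluecker r) = coneTangent (pluecker '' B) q := by
    rw [h, embTangent_mk]
  obtain ⟨c, hc, hqc⟩ := exists_eq_smul_plueckerVec h
  have hT' : coneTangent (pluecker '' B) q = coneTangent (pluecker '' B) (plueckerVec r) := by
    rw [hqc, coneTangent_smul _ _ hc]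
  rw [hT'] at hξ
  obtain ⟨A, hA⟩ := exists_plueckerDifferential_eq (Submodule.smul_mem _ c⁻¹ hξ)
  refine ⟨r.1.mkQ ∘ₗ A, Submodule.mem_map_of_mem (f := LinearMap.compRight K r.1.mkQ) ?_,
    fun w => ?_⟩
  · rw [Submodule.mem_comap, hA, hT, hT']
    exact Submodule.smul_mem _ _ hξ
  · have hact : (⟨act q w, act_mem h w⟩ : r.1) =
        c • ⟨act (plueckerVec r) w, act_plueckerVec_mem r w⟩ := by
      ext1
      simp [hqc]
    rw [hact, map_smul, LinearMap.comp_apply,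
      ← mkQ_act_plueckerDifferential r A w (act_plueckerVec_mem r w), hA, map_smul,
      LinearMap.smul_apply, map_smul, smul_inv_smul₀ hc]

theorem exists_mem_coneTangent {B : Set (Line K N)} {r : Line K N} {q : PlIdx N → K} {hq : q ≠ 0}
    (h : pluecker r = Projectivization.mk K q hq) {θ : r.1 →ₗ[K] Vec K N ⧸ r.1}
    (hθ : θ ∈ tangentSpace B r) : ∃ ξ ∈ coneTangent (pluecker '' B) q,
      ∀ w, θ ⟨act q w, act_mem h w⟩ = r.1.mkQ (act ξ w) := by
  have hT : embTangent (pluecker '' B) (pluecker r) = coneTangent (pluecker '' B) q := by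
    rw [h, embTangent_mk]
  obtain ⟨c, hc, hqc⟩ := exists_eq_smul_plueckerVec h
  rw [tangentSpace, Submodule.mem_map, hT] at hθ
  obtain ⟨A, hA, rfl⟩ := hθ
  refine ⟨c • plueckerDifferential r A, Submodule.smul_mem _ _ hA, fun w => ?_⟩
  have hact : (⟨act q w, act_mem h w⟩ : r.1) =
      c • ⟨act (plueckerVec r) w, act_plueckerVec_mem r w⟩ := by
    ext1
    simp [hqc]
  rw [hact, map_smul, map_smul, LinearMap.smul_apply, map_smul,
    mkQ_act_plueckerDifferential r A w (act_plueckerVec_mem r w)]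
  rfl

/-- T_rB lies in the image of the tangent space to the cone at q, and the radial direction q is a
nonzero tangent vector mapping to zero. This loss of one dimension makes the bound n rather than n +
1. -/
theorem finrank_tangentSpace_lt [Infinite K] {B : Set (Line K N)} {r : Line K N} (hr : r ∈ B)
    {q : PlIdx N → K} {hq : q ≠ 0} (h : pluecker r = Projectivization.mk K q hq) :
    Module.finrank K (tangentSpace B r) < Module.finrank K (coneTangent (pluecker '' B) q) := by
  obtain ⟨s, hs⟩ := LinearMap.exists_rightInverse_of_surjective
    ((act q).codRestrict r.1 (act_mem h)) (by
      rw [LinearMap.range_codRestrict, range_act h, Submodule.comap_subtype_self])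
  let Ψ : (PlIdx N → K) →ₗ[K] (r.1 →ₗ[K] Vec K N ⧸ r.1) :=
    (LinearMap.compRight K r.1.mkQ).comp ((LinearMap.lcomp K (Vec K N) s).comp act)
  have hΨ : ∀ ξ v, Ψ ξ v = r.1.mkQ (act ξ (s v)) := fun _ _ => rfl
  have hle : tangentSpace B r ≤ LinearMap.range (Ψ.domRestrict (coneTangent (pluecker '' B) q)) := by
    intro θ hθ
    obtain ⟨ξ, hξ, hw⟩ := exists_mem_coneTangent h hθ
    refine ⟨⟨ξ, hξ⟩, ?_⟩
    ext v
    rw [LinearMap.domRestrict_apply, hΨ, ← hw]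
    congr 1
    exact LinearMap.congr_fun hs v
  have hqT : q ∈ coneTangent (pluecker '' B) q := self_mem_coneTangent ⟨hq, r, hr, h⟩
  have hker : 0 < Module.finrank K (LinearMap.ker
      (Ψ.domRestrict (coneTangent (pluecker '' B) q))) := by
    refine Submodule.one_le_finrank_iff.mpr ((Submodule.ne_bot_iff _).mpr ⟨⟨q, hqT⟩, ?_, ?_⟩)
    · rw [LinearMap.mem_ker]
      ext v
      rw [LinearMap.domRestrict_apply, hΨ, LinearMap.zero_apply, Submodule.mkQ_apply,
        Submodule.Quotient.mk_eq_zero]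
      exact act_mem h _
    · exact fun h0 => hq (congrArg Subtype.val h0)
  have h1 := LinearMap.finrank_range_add_finrank_ker
    (Ψ.domRestrict (coneTangent (pluecker '' B) q))
  have h2 := Submodule.finrank_mono hle
  omega

end Pluecker

end FocalLines

namespace FocalLines

/-! ### Tangent spaces at a generic point -/

section GenericPoint

open MvPolynomial

/-- At a generic point of `Z`, with coordinates `x` in a field `L`, the dimension of the tangent
space to the cone is at most the dimension of the cone. -/
theorem finrank_orth_gradients_le {K L : Type*} {σ : Type} [Field K] [CharZero K] [Fintype σ]
    [Field L] [Algebra K L] {I : Ideal (MvPolynomial σ K)} (hI : I.IsPrime) {d : ℕ}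
    (hd : Algebra.trdeg K (MvPolynomial σ K ⧸ I) = (d : Cardinal)) (x : σ → L)
    (hx : ∀ F : MvPolynomial σ K, aeval x F = 0 ↔ F ∈ I) :
    Module.finrank L
      (orth ((fun F i => aeval x (pderiv i F)) '' (I : Set (MvPolynomial σ K)))) ≤ d := by
  obtain ⟨s, hs⟩ := exists_isTranscendenceBasis K (MvPolynomial σ K ⧸ I)
  have hcard := hs.cardinalMk_eq_trdeg.trans hd
  have hfin : Finite s := by
    rw [← Cardinal.lt_aleph0_iff_finite, hcard]
    exact Cardinal.natCast_lt_aleph0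
  have := Fintype.ofFinite s
  have hcard' : Fintype.card s = d := by
    rw [Cardinal.mk_fintype] at hcard
    exact_mod_cast hcard
  choose t ht using fun j : s => Ideal.Quotient.mk_surjective (I := I) (j : MvPolynomial σ K ⧸ I)
  let f : (MvPolynomial σ K ⧸ I) →ₐ[K] L := Ideal.Quotient.liftₐ I (aeval x) fun F hF => (hx F).mpr hF
  have hf : Function.Injective f := by
    rw [injective_iff_map_eq_zero]
    intro a ha
    obtain ⟨F, rfl⟩ := Ideal.Quotient.mk_surjective a
    exact Ideal.Quotient.eq_zero_iff_mem.mpr ((hx F).mp ha)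
  -- Λ is the differential of d functions forming a transcendence basis. A tangent vector ξ killed
  -- by Λ defines a deformation of the coordinate ring that fixes this basis, so ξ = 0.
  let Λ : (σ → L) →ₗ[L] (s → L) :=
    (Matrix.of fun j i => aeval x (pderiv i (t j))).mulVecLin
  set T := orth ((fun F i => aeval x (pderiv i F)) '' (I : Set (MvPolynomial σ K))) with hT
  have hinj : Function.Injective (Λ.domRestrict T) := by
    rw [← LinearMap.ker_eq_bot, LinearMap.ker_eq_bot']
    rintro ⟨ξ, hξ⟩ h0
    have hdef : ∀ F : MvPolynomial σ K,
        aeval (fun i => (TrivSqZeroExt.inl (x i) + TrivSqZeroExt.inr (ξ i) : TrivSqZeroExt L L)) F =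
          TrivSqZeroExt.inl (aeval x F) + TrivSqZeroExt.inr (∑ i, aeval x (pderiv i F) * ξ i) :=
      fun F => aeval_inl_add_inr x ξ F
    let h : (MvPolynomial σ K ⧸ I) →ₐ[K] TrivSqZeroExt L L := Ideal.Quotient.liftₐ I
      (aeval fun i => TrivSqZeroExt.inl (x i) + TrivSqZeroExt.inr (ξ i)) fun F hF => by
        have h1 : ∑ i, aeval x (pderiv i F) * ξ i = 0 := hξ _ ⟨F, hF, rfl⟩
        rw [hdef, (hx F).mpr hF, h1]
        simp
    have hh : ∀ F : MvPolynomial σ K, h (Ideal.Quotient.mk I F) =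
      TrivSqZeroExt.inl (aeval x F) + TrivSqZeroExt.inr (∑ i, aeval x (pderiv i F) * ξ i) := hdef
    have key := snd_eq_zero_of_isTranscendenceBasis f hf h (fun a => by
      obtain ⟨F, rfl⟩ := Ideal.Quotient.mk_surjective a
      rw [hh, TrivSqZeroExt.fst_add, TrivSqZeroExt.fst_inl, TrivSqZeroExt.fst_inr, add_zero]
      rfl) hs (fun j => by
      rw [← ht j, hh]
      have := congrFun h0 j
      simpa [Λ, Matrix.mulVec, dotProduct] using this)
    ext i
    have h1 := key (Ideal.Quotient.mk I (X i))
    have h2 : h (Ideal.Quotient.mk I (X i)) =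
        TrivSqZeroExt.inl (x i) + TrivSqZeroExt.inr (ξ i) := by
      change aeval _ (X i) = _
      rw [aeval_X]
    rw [h2] at h1
    simpa using h1
  have := LinearMap.finrank_le_finrank_of_injective hinj
  rwa [Module.finrank_fintype_fun_eq_card, hcard'] at this

/-- At a generic point of the image of a polynomial map, there are `d` independent vectors in the
image of its differential, where `d` is the transcendence degree of the coordinate ring of the
image. -/
theorem exists_deformations_of_trdeg {K L : Type*} {τ : Type} [Field K] [CharZero K] [Fintype τ]
    [Field L] [Algebra K L] {J : Ideal (MvPolynomial τ K)} (hJ : J.IsPrime) {d : ℕ}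
    (hd : Algebra.trdeg K (MvPolynomial τ K ⧸ J) = (d : Cardinal)) (x : τ → L)
    (hx : ∀ F : MvPolynomial τ K, aeval x F = 0 ↔ F ∈ J) :
    ∃ h : Fin d → (L →ₐ[K] TrivSqZeroExt L L), (∀ k a, (h k a).fst = a) ∧
      LinearIndependent L fun k i => (h k (x i)).snd := by
  obtain ⟨s, hs⟩ := exists_isTranscendenceBasis K (MvPolynomial τ K ⧸ J)
  have hcard := hs.cardinalMk_eq_trdeg.trans hd
  have hfin : Finite s := by
    rw [← Cardinal.lt_aleph0_iff_finite, hcard]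
    exact Cardinal.natCast_lt_aleph0
  have := Fintype.ofFinite s
  have hcard' : Fintype.card s = d := by
    rw [Cardinal.mk_fintype] at hcard
    exact_mod_cast hcard
  let e : Fin d ≃ s := (Fintype.equivFinOfCardEq hcard').symm
  choose t ht using fun j : s => Ideal.Quotient.mk_surjective (I := J) (j : MvPolynomial τ K ⧸ J)
  let f : (MvPolynomial τ K ⧸ J) →ₐ[K] L := Ideal.Quotient.liftₐ J (aeval x) fun F hF => (hx F).mpr hF
  have hf : Function.Injective f := by
    rw [injective_iff_map_eq_zero]
    intro a ha
    obtain ⟨F, rfl⟩ := Ideal.Quotient.mk_surjective a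
    exact Ideal.Quotient.eq_zero_iff_mem.mpr ((hx F).mp ha)
  have hli : AlgebraicIndependent K fun k : Fin d => aeval x (t (e k)) := by
    have h1 := (hs.1.map' hf).comp e e.injective
    convert h1 using 2 with k
    change _ = f (e k : MvPolynomial τ K ⧸ J)
    rw [← ht (e k)]
    rfl
  -- The k-th deformation moves the k-th basis element at unit speed and fixes the others. By the
  -- chain rule the gradients of the basis elements are dual to the velocities of x, which are
  -- therefore independent.
  choose h hfst hsnd using fun k : Fin d =>
    exists_deformation_of_algebraicIndependent hli (Pi.single k 1 : Fin d → L)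
  refine ⟨h, hfst, ?_⟩
  have key : ∀ k j, ∑ i, aeval x (pderiv i (t (e j))) * (h k (x i)).snd =
      (Pi.single k 1 : Fin d → L) j := by
    intro k j
    rw [← hsnd k j, comp_aeval_apply, snd_aeval_eq]
    simp only [hfst]
  rw [Fintype.linearIndependent_iff]
  intro c hc j
  have h1 : ∑ k, c k * ∑ i, aeval x (pderiv i (t (e j))) * (h k (x i)).snd = 0 := by
    simp only [Finset.mul_sum]
    rw [Finset.sum_comm]
    refine Finset.sum_eq_zero fun i _ => ?_
    have h2 := congrFun hc i
    simp only [Finset.sum_apply, Pi.smul_apply, smul_eq_mul, Pi.zero_apply] at h2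
    calc _ = aeval x (pderiv i (t (e j))) * ∑ k, c k * (h k (x i)).snd := by
          rw [Finset.mul_sum]
          exact Finset.sum_congr rfl fun k _ => by ring
      _ = 0 := by rw [h2, mul_zero]
  simpa [key, Pi.single_apply] using h1

end GenericPoint

/-! ### The generic point of the generic line -/

section IncidenceRing

open MvPolynomial

variable {K : Type*} [Field K] {N : ℕ} (B : Set (Line K N))

/-- The coordinate ring of the cone over `B`. -/
abbrev CoordRing : Type _ := MvPolynomial (PlIdx N) K ⧸ idealOf (pluecker '' B)

/-- The coordinate ring of the product of the cone over `B` and `V`. -/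
def IncidenceRing : Type _ := MvPolynomial (Fin (N + 1)) (CoordRing B)

instance : CommRing (IncidenceRing B) :=
  inferInstanceAs (CommRing (MvPolynomial (Fin (N + 1)) (CoordRing B)))

instance : Algebra K (IncidenceRing B) :=
  inferInstanceAs (Algebra K (MvPolynomial (Fin (N + 1)) (CoordRing B)))

variable {B} in
theorem isDomain_incidenceRing (hB : (idealOf (pluecker '' B)).IsPrime) :
    IsDomain (IncidenceRing B) := by
  have : IsDomain (CoordRing B) := Ideal.Quotient.isDomain _
  exact inferInstanceAs (IsDomain (MvPolynomial (Fin (N + 1)) (CoordRing B)))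

/-- The inclusion of the coordinate ring of the cone over `B`. -/
def coordToIncidence : CoordRing B →ₐ[K] IncidenceRing B :=
  (IsScalarTower.toAlgHom K (CoordRing B) (MvPolynomial (Fin (N + 1)) (CoordRing B)) :)

/-- The Plücker coordinates, as elements of the incidence ring. -/
def genericLine (p : PlIdx N) : IncidenceRing B :=
  coordToIncidence B (Ideal.Quotient.mk _ (X p))

/-- The coordinates on `V`, as elements of the incidence ring. -/
def genericCoord (j : Fin (N + 1)) : IncidenceRing B :=
  (X j : MvPolynomial (Fin (N + 1)) (CoordRing B))

/-- The coordinates of the generic point of the generic line. -/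
def genericVec (i : Fin (N + 1)) : IncidenceRing B :=
  ∑ j, genericLine B (i, j) * genericCoord B j

variable {B}

/-- Evaluation of elements of the incidence ring. -/
def evalIncidence {E : Type*} [CommRing E] [Algebra K E] (z : PlIdx N → E)
    (hz : ∀ F ∈ idealOf (pluecker '' B), aeval z F = 0) (w : Fin (N + 1) → E) :
    IncidenceRing B →ₐ[K] E :=
  ({ eval₂Hom (Ideal.Quotient.liftₐ _ (aeval z) hz : CoordRing B →ₐ[K] E).toRingHom w with
    commutes' := fun a => by
      change eval₂ _ _ (algebraMap K (MvPolynomial (Fin (N + 1)) (CoordRing B)) a) = _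
      rw [IsScalarTower.algebraMap_apply K (CoordRing B) (MvPolynomial (Fin (N + 1)) (CoordRing B)),
        algebraMap_eq, eval₂_C]
      exact AlgHom.commutes _ a } : MvPolynomial (Fin (N + 1)) (CoordRing B) →ₐ[K] E)

variable {E : Type*} [CommRing E] [Algebra K E] {z : PlIdx N → E}
    {hz : ∀ F ∈ idealOf (pluecker '' B), aeval z F = 0} {w : Fin (N + 1) → E}

theorem evalIncidence_genericLine (p : PlIdx N) :
    evalIncidence z hz w (genericLine B p) = z p := by
  change eval₂ _ _ (C _) = _
  rw [eval₂_C]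
  change aeval z (X p) = z p
  rw [aeval_X]

theorem evalIncidence_genericCoord (i : Fin (N + 1)) :
    evalIncidence z hz w (genericCoord B i) = w i :=
  eval₂_X _ _ _

theorem evalIncidence_genericVec (i : Fin (N + 1)) :
    evalIncidence z hz w (genericVec B i) = ∑ j, z (i, j) * w j := by
  simp only [genericVec, map_sum, map_mul, evalIncidence_genericLine, evalIncidence_genericCoord]

theorem aeval_eq_zero_of_mem_coneOf {q : PlIdx N → K} (hq : q ∈ coneOf (pluecker '' B)) :
    ∀ F ∈ idealOf (pluecker '' B), aeval q F = 0 := fun F hF => by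
  rw [aeval_eq_eval]
  exact mem_idealOf.mp hF q hq

theorem aeval_genericLine (F : MvPolynomial (PlIdx N) K) :
    aeval (genericLine B) F = coordToIncidence B (Ideal.Quotient.mk _ F) := by
  have : (aeval (genericLine B) : MvPolynomial (PlIdx N) K →ₐ[K] IncidenceRing B) =
      (coordToIncidence B).comp (Ideal.Quotient.mkₐ K (idealOf (pluecker '' B))) := by
    ext p
    simp [genericLine]
  rw [this]
  rfl

theorem coordToIncidence_injective : Function.Injective (coordToIncidence B) :=
  C_injective (Fin (N + 1)) (CoordRing B)

theorem aeval_genericLine_eq_zero_iff (F : MvPolynomial (PlIdx N) K) :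
    aeval (genericLine B) F = 0 ↔ F ∈ idealOf (pluecker '' B) := by
  rw [aeval_genericLine, map_eq_zero_iff _ coordToIncidence_injective,
    Ideal.Quotient.eq_zero_iff_mem]

/-- A nonzero element of the incidence ring does not vanish at the general point of the general
line. -/
theorem exists_polynomial_of_ne_zero {g : IncidenceRing B} (hg : g ≠ 0) :
    ∃ F ∉ idealOf (pluecker '' B), ∀ (q : PlIdx N → K) (hq : q ∈ coneOf (pluecker '' B)),
      eval q F ≠ 0 → ∃ G : MvPolynomial (Fin (N + 1)) K, G ≠ 0 ∧
        ∀ w, evalIncidence q (aeval_eq_zero_of_mem_coneOf hq) w g = eval w G := by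
  let g' : MvPolynomial (Fin (N + 1)) (CoordRing B) := g
  -- F is a lift of a nonzero coefficient of g as a polynomial in w. Where F does not vanish at q,
  -- that coefficient survives, so g(q, ·) is a nonzero polynomial.
  obtain ⟨m, hm⟩ : ∃ m, coeff m g' ≠ 0 := ne_zero_iff.mp hg
  obtain ⟨F, hF⟩ := Ideal.Quotient.mk_surjective (coeff m g')
  refine ⟨F, fun h => hm (by rw [← hF, Ideal.Quotient.eq_zero_iff_mem]; exact h),
    fun q hq hne => ?_⟩
  refine ⟨map (Ideal.Quotient.liftₐ _ (aeval q) (aeval_eq_zero_of_mem_coneOf hq) :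
    CoordRing B →ₐ[K] K).toRingHom g', ne_zero_iff.mpr ⟨m, ?_⟩, fun w => ?_⟩
  · rw [coeff_map, ← hF]
    change aeval q F ≠ 0
    rwa [aeval_eq_eval]
  · rw [eval_map]
    rfl

end IncidenceRing

/-! ### The union of the lines as the image of the incidence map -/

section UnionOfLines

open MvPolynomial

variable {K : Type*} [Field K] {N : ℕ} {B : Set (Line K N)}

theorem mem_coneOf_unionOfLines {v : Vec K N} :
    v ∈ coneOf (unionOfLines B) ↔ v ≠ 0 ∧ ∃ r ∈ B, v ∈ r.1 := by
  simp only [coneOf, unionOfLines, Set.mem_ofPred_eq, Projectivization.submodule_mk,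
    Submodule.span_singleton_le_iff_mem]
  exact ⟨fun ⟨h, h'⟩ => ⟨h, h'⟩, fun ⟨h, h'⟩ => ⟨h, h'⟩⟩

theorem exists_genericVec_ne_zero (hB : B.Nonempty) : ∃ i, genericVec B i ≠ 0 := by
  obtain ⟨r, hr⟩ := hB
  have hq := rep_mem_coneOf (Z := pluecker '' B) ⟨r, hr, rfl⟩
  obtain ⟨⟨a, b⟩, hab⟩ := Function.ne_iff.mp hq.1
  refine ⟨a, fun h0 => hab ?_⟩
  have h := evalIncidence_genericVec (hz := aeval_eq_zero_of_mem_coneOf hq)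
    (w := Pi.single b 1) a
  rw [h0, map_zero] at h
  simpa [Pi.single_apply] using h.symm

/-- The union of the lines of `B` is the image of the bilinear map `(q, w) ↦ act q w`. -/
theorem aeval_genericVec_eq_zero_iff [Infinite K] (hB : (idealOf (pluecker '' B)).IsPrime)
    (hne : B.Nonempty) (F : MvPolynomial (Fin (N + 1)) K) :
    aeval (genericVec B) F = 0 ↔ F ∈ idealOf (unionOfLines B) := by
  have := isDomain_incidenceRing hB
  constructor
  · intro h
    rw [mem_idealOf]
    intro v hv
    obtain ⟨hv0, r, hr, hvr⟩ := mem_coneOf_unionOfLines.mp hv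
    have hq := rep_mem_coneOf (Z := pluecker '' B) ⟨r, hr, rfl⟩
    rw [← range_act (hq := Projectivization.rep_nonzero _) (Projectivization.mk_rep _).symm] at hvr
    obtain ⟨w, rfl⟩ := hvr
    have h1 := congrArg (evalIncidence _ (aeval_eq_zero_of_mem_coneOf hq) w) h
    rw [comp_aeval_apply, map_zero] at h1
    simp only [evalIncidence_genericVec] at h1
    rw [← aeval_eq_eval]
    exact h1
  · intro h
    by_contra h0
    obtain ⟨i, hi⟩ := exists_genericVec_ne_zero hne
    -- The coordinate `genericVec B i` is included as a factor so that `act q w` is nonzero and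
    -- represents a point of the union.
    obtain ⟨P, hP, hg⟩ := exists_polynomial_of_ne_zero (mul_ne_zero h0 hi)
    obtain ⟨q, hq, hqP⟩ := exists_eval_ne_zero_of_notMem_idealOf hP
    obtain ⟨G, hG, hGw⟩ := hg q hq hqP
    obtain ⟨w, hw⟩ : ∃ w, eval w G ≠ 0 := by
      by_contra! hall
      exact hG (MvPolynomial.funext fun w => by rw [hall w, map_zero])
    rw [← hGw, map_mul, comp_aeval_apply] at hw
    simp only [evalIncidence_genericVec] at hw
    obtain ⟨r, hr, hq0, he⟩ := exists_pluecker_eq_mk hq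
    have hv : act q w ∈ coneOf (unionOfLines B) := by
      refine mem_coneOf_unionOfLines.mpr ⟨fun hz => right_ne_zero_of_mul hw ?_, r, hr, act_mem he w⟩
      exact congrFun hz i
    apply left_ne_zero_of_mul hw
    rw [aeval_eq_eval]
    exact mem_idealOf.mp h _ hv

/-- The image of the differential of `(q, w) ↦ act q w`. -/
def incidenceImage (B : Set (Line K N)) (q : PlIdx N → K) (w : Vec K N) :
    Submodule K (Vec K N) :=
  (coneTangent (pluecker '' B) q).map (act.flip w) ⊔ LinearMap.range (act q)

theorem mem_incidenceImage {q : PlIdx N → K} {w a : Vec K N} :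
    a ∈ incidenceImage B q w ↔
      ∃ ξ ∈ coneTangent (pluecker '' B) q, ∃ ω, act ξ w + act q ω = a := by
  simp [incidenceImage, Submodule.mem_sup]

/-- Chain rule: an equation F of the union vanishes identically on the incidence ring, in particular
at the dual number point (q + εξ, w + εω). The ε-part is dF at `act q w`, applied to `act ξ w + act
q ω`. -/
theorem incidenceImage_le [Infinite K] (hB : (idealOf (pluecker '' B)).IsPrime)
    {q : PlIdx N → K} (hq : q ∈ coneOf (pluecker '' B)) (w : Vec K N) :
    incidenceImage B q w ≤ coneTangent (unionOfLines B) (act q w) := by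
  have hne : B.Nonempty := by
    obtain ⟨r, hr, -⟩ := exists_pluecker_eq_mk hq
    exact ⟨r, hr⟩
  intro a ha
  obtain ⟨ξ, hξ, ω, rfl⟩ := mem_incidenceImage.mp ha
  rw [mem_coneTangent] at hξ ⊢
  intro F hF
  have h0 := (aeval_genericVec_eq_zero_iff hB hne F).mpr hF
  have h1 := congrArg (evalIncidence
    (fun p => (TrivSqZeroExt.inl (q p) + TrivSqZeroExt.inr (ξ p) : TrivSqZeroExt K K))
    (fun G hG => by
      rw [aeval_inl_add_inr, aeval_eq_zero_of_mem_coneOf hq G hG]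
      have := hξ G hG
      rw [polyDifferential_apply] at this
      simp [aeval_eq_eval, this])
    (fun j => TrivSqZeroExt.inl (w j) + TrivSqZeroExt.inr (ω j))) h0
  rw [comp_aeval_apply, map_zero] at h1
  rw [← snd_aeval_inl_add_inr, ← TrivSqZeroExt.snd_zero (R := K) (M := K), ← h1]
  congr 3
  ext i
  · simp [evalIncidence_genericVec, act_apply, TrivSqZeroExt.fst_sum]
  · simp [evalIncidence_genericVec, act_apply, TrivSqZeroExt.snd_sum, Finset.sum_add_distrib,
      add_comm, mul_comm]

end UnionOfLines

end FocalLines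

namespace FocalLines

/-! ### Evaluation of tangent vectors at the points of a line -/

section LineVectors

open MvPolynomial

variable {K : Type*} [Field K] {N : ℕ} {B : Set (Line K N)}

/-- The vector of `r̂` with given coordinates. -/
def lineVec (r : Line K N) (x : Fin 2 → K) : r.1 := ∑ k, x k • lineBasis r k

/-- The line `r` behaves like a general line of `B` with union `X`. -/
structure IsGeneralLine (n : ℕ) (B : Set (Line K N)) (X : Set (ℙ K (Vec K N)))
    (r : Line K N) : Prop where
  finrank_tangentSpace : Module.finrank K (tangentSpace B r) = n
  exists_polynomial : ∃ G : MvPolynomial (Fin 2) K, G ≠ 0 ∧ ∀ x, eval x G ≠ 0 →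
    (lineVec r x : Vec K N) ≠ 0 ∧ (∀ η ∈ tangentSpace B r, η (lineVec r x) = 0 → η = 0) ∧
    Module.finrank K (coneTangent X (lineVec r x : Vec K N)) = n + 2 ∧
    ∀ a, a ∈ coneTangent X (lineVec r x : Vec K N) ↔
      ∃ η ∈ tangentSpace B r, r.1.mkQ a = η (lineVec r x)

/-- The evaluation of tangent vectors at `v`. -/
def evalTangent (B : Set (Line K N)) (r : Line K N) (v : r.1) :
    tangentSpace B r →ₗ[K] Vec K N ⧸ r.1 :=
  LinearMap.applyₗ v ∘ₗ (tangentSpace B r).subtype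

theorem evalTangent_apply (r : Line K N) (v : r.1) (η : tangentSpace B r) :
    evalTangent B r v η = η.1 v := rfl

/-- The directions ω contribute all of r̂, so only the contribution of ξ modulo r̂ matters, and this
is an element of T_rB evaluated at `act q w`. -/
theorem incidenceImage_eq {r : Line K N} {q : PlIdx N → K} {hq : q ≠ 0}
    (h : pluecker r = Projectivization.mk K q hq) (w : Vec K N) :
    incidenceImage B q w =
      (LinearMap.range (evalTangent B r ⟨act q w, act_mem h w⟩)).comap r.1.mkQ := by
  ext a
  rw [mem_incidenceImage, Submodule.mem_comap]
  have hz : ∀ ω, r.1.mkQ (act q ω) = 0 := fun ω => by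
    rw [Submodule.mkQ_apply, Submodule.Quotient.mk_eq_zero]
    exact act_mem h ω
  constructor
  · rintro ⟨ξ, hξ, ω, rfl⟩
    obtain ⟨θ, hθ, hθw⟩ := exists_mem_tangentSpace h hξ
    exact ⟨⟨θ, hθ⟩, by rw [evalTangent_apply, hθw, map_add, hz, add_zero]⟩
  · rintro ⟨θ, hθ⟩
    obtain ⟨ξ, hξ, hξw⟩ := exists_mem_coneTangent h θ.2
    rw [evalTangent_apply, hξw, eq_comm, ← sub_eq_zero, ← map_sub, Submodule.mkQ_apply,
      Submodule.Quotient.mk_eq_zero, ← range_act h] at hθ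
    obtain ⟨ω, hω⟩ := hθ
    exact ⟨ξ, hξ, ω, by rw [hω]; abel⟩

theorem finrank_comap_mkQ {V : Type*} [AddCommGroup V] [Module K V] [FiniteDimensional K V]
    (S : Submodule K V) (T : Submodule K (V ⧸ S)) :
    Module.finrank K (T.comap S.mkQ) = Module.finrank K T + Module.finrank K S := by
  have h1 := LinearMap.finrank_range_add_finrank_ker (S.mkQ.domRestrict (T.comap S.mkQ))
  have hle : S ≤ T.comap S.mkQ := fun x hx => by
    rw [Submodule.mem_comap, Submodule.mkQ_apply, (Submodule.Quotient.mk_eq_zero S).mpr hx]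
    exact T.zero_mem
  rw [LinearMap.range_domRestrict, LinearMap.ker_domRestrict, Submodule.ker_mkQ,
    Submodule.map_comap_eq_of_surjective S.mkQ_surjective] at h1
  rw [← h1, (Submodule.comapSubtypeEquivOfLe hle).finrank_eq]

/-- The preimage of the range has dimension rank f + s, so n ≤ rank f ≤ dim T ≤ n and equality holds
throughout. -/
theorem injective_of_finrank_comap_mkQ {V T : Type*} [AddCommGroup V] [Module K V]
    [FiniteDimensional K V] [AddCommMonoid T] [Module K T] [Module.Finite K T]
    {S : Submodule K V} {s n : ℕ} (hS : Module.finrank K S = s) (f : T →ₗ[K] V ⧸ S)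
    (hT : Module.finrank K T ≤ n)
    (h : n + s ≤ Module.finrank K ((LinearMap.range f).comap S.mkQ)) :
    Module.finrank K T = n ∧ Function.Injective f := by
  let _ := Module.addCommMonoidToAddCommGroup K (M := T)
  have h1 := LinearMap.finrank_range_add_finrank_ker f
  rw [finrank_comap_mkQ, hS] at h
  refine ⟨by omega, ?_⟩
  rw [← LinearMap.ker_eq_bot, ← Submodule.finrank_eq_zero (R := K)]
  omega

end LineVectors

/-! ### Tangent spaces at the general point of the general line -/

section GeneralLine

open MvPolynomial

variable {K : Type*} [Field K] [CharZero K] {n N : ℕ} {B : Set (Line K N)}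

/-- If `x i = ∑ j, p (i, j) * w j` generate a ring of transcendence degree `d`, then at the general
point the differential of `(p, w) ↦ x` has rank at least `d` on the space of vectors tangent to all
relations between the `p (i, j)`. -/
theorem exists_linearIndependent_deformations {R : Type*} [CommRing R] [IsDomain R] [Algebra K R]
    {J : Ideal (MvPolynomial (Fin (N + 1)) K)} (hJ : J.IsPrime) {d : ℕ}
    (hd : Algebra.trdeg K (MvPolynomial (Fin (N + 1)) K ⧸ J) = (d : Cardinal))
    (p : PlIdx N → R) (w : Fin (N + 1) → R)
    (hx : ∀ F : MvPolynomial (Fin (N + 1)) K,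
      aeval (fun i => ∑ j, p (i, j) * w j) F = 0 ↔ F ∈ J) :
    ∃ (ξ : Fin d → PlIdx N → R) (ω : Fin d → Fin (N + 1) → R) (g : R), g ≠ 0 ∧
      (∀ k, ∀ F : MvPolynomial (PlIdx N) K, aeval p F = 0 →
        ∑ s, aeval p (pderiv s F) * ξ k s = 0) ∧
      ∀ φ : R →ₐ[K] K, φ g ≠ 0 → LinearIndependent K fun k i =>
        ∑ j, (φ (ξ k (i, j)) * φ (w j) + φ (p (i, j)) * φ (ω k j)) := by
  let L := FractionRing R
  let ι : R →ₐ[K] L := IsScalarTower.toAlgHom K R L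
  have hι : Function.Injective ι := IsFractionRing.injective R L
  have hx' : ∀ F : MvPolynomial (Fin (N + 1)) K,
      aeval (fun i => ι (∑ j, p (i, j) * w j)) F = 0 ↔ F ∈ J := by
    intro F
    rw [← hx, ← comp_aeval_apply, map_eq_zero_iff ι hι]
  obtain ⟨h, hfst, hli⟩ := exists_deformations_of_trdeg hJ hd _ hx'
  -- The velocities of p and w lie in the fraction field. Multiplying them by a common denominator b
  -- brings them into R, where they can be specialised, and scales the independent vectors by the
  -- unit b of L.
  obtain ⟨b, hb⟩ := IsLocalization.exist_integer_multiples_of_finite (nonZeroDivisors R)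
    (Sum.elim (fun x : Fin d × PlIdx N => (h x.1 (ι (p x.2))).snd)
      fun x : Fin d × Fin (N + 1) => (h x.1 (ι (w x.2))).snd)
  choose H hH using hb
  have hb0 : ι (b : R) ≠ 0 := by
    rw [map_ne_zero_iff ι hι]
    exact nonZeroDivisors.coe_ne_zero b
  have h1 : ∀ k s, ι (H (Sum.inl (k, s))) = ι b * (h k (ι (p s))).snd := fun k s => by
    refine (hH _).trans ?_
    rw [Algebra.smul_def]
    rfl
  have h2 : ∀ k j, ι (H (Sum.inr (k, j))) = ι b * (h k (ι (w j))).snd := fun k j => by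
    refine (hH _).trans ?_
    rw [Algebra.smul_def]
    rfl
  have hli' : LinearIndependent L fun k i => algebraMap R L
      (∑ j, (H (Sum.inl (k, (i, j))) * w j + p (i, j) * H (Sum.inr (k, j)))) := by
    have h3 := hli.units_smul fun _ => Units.mk0 _ hb0
    suffices h4 : (fun k i => algebraMap R L
        (∑ j, (H (Sum.inl (k, (i, j))) * w j + p (i, j) * H (Sum.inr (k, j))))) =
        (fun _ : Fin d => Units.mk0 (ι (b : R)) hb0) •
          fun k i => (h k (ι (∑ j, p (i, j) * w j))).snd by
      rw [h4]
      exact h3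
    ext k i
    rw [Pi.smul_apply', Pi.smul_apply, Units.smul_mk0, smul_eq_mul]
    change ι _ = _
    simp only [map_sum, map_add, map_mul, h1, h2, TrivSqZeroExt.snd_sum,
      TrivSqZeroExt.snd_mul, hfst, smul_eq_mul, MulOpposite.smul_eq_mul_unop, MulOpposite.unop_op]
    rw [Finset.mul_sum]
    exact Finset.sum_congr rfl fun j _ => by ring
  obtain ⟨g, hg, Hg⟩ := exists_linearIndependent_specialization L K _ hli'
  refine ⟨fun k s => H (Sum.inl (k, s)), fun k j => H (Sum.inr (k, j)), g, hg, fun k F hF => ?_,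
    fun φ hφ => ?_⟩
  · have h3 : h k (ι (aeval p F)) = 0 := by
      rw [hF, map_zero, map_zero]
    rw [comp_aeval_apply, comp_aeval_apply] at h3
    have h4 := congrArg TrivSqZeroExt.snd h3
    rw [snd_aeval_eq, TrivSqZeroExt.snd_zero] at h4
    simp only [hfst] at h4
    apply hι
    rw [map_zero, map_sum]
    calc _ = ι b * ∑ s, aeval (fun s => ι (p s)) (pderiv s F) * (h k (ι (p s))).snd := by
            rw [Finset.mul_sum]
            refine Finset.sum_congr rfl fun s _ => ?_
            rw [map_mul, h1, comp_aeval_apply]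
            ring
      _ = 0 := by rw [h4, mul_zero]
  · have h3 := Hg (φ : R →+* K) hφ
    simpa only [RingHom.coe_coe, map_sum, map_add, map_mul] using h3

/-- Over the fraction field y is a generic point of Z, where `finrank_orth_gradients_le` bounds the
tangent dimension. The finitely many gradients that give the bound stay independent off a
hypersurface g = 0. -/
theorem exists_finrank_coneTangent_le {σ : Type} [Fintype σ] {R : Type*} [CommRing R] [IsDomain R]
    [Algebra K R] {Z : Set (ℙ K (σ → K))} (hZ : (idealOf Z).IsPrime) {d : ℕ}
    (hd : coneDim Z = (d : Cardinal)) (y : σ → R)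
    (hy : ∀ F : MvPolynomial σ K, aeval y F = 0 ↔ F ∈ idealOf Z) :
    ∃ g : R, g ≠ 0 ∧ ∀ φ : R →ₐ[K] K, φ g ≠ 0 →
      Module.finrank K (coneTangent Z fun i => φ (y i)) ≤ d := by
  let L := FractionRing R
  let ι : R →ₐ[K] L := IsScalarTower.toAlgHom K R L
  have hι : Function.Injective ι := IsFractionRing.injective R L
  obtain ⟨g, hg, H⟩ := exists_finrank_orth_specialization_le L K
    ((fun F p => aeval y (pderiv p F)) '' (idealOf Z : Set (MvPolynomial σ K))) d (by
    have h1 := finrank_orth_gradients_le hZ hd (fun p => ι (y p)) fun F => by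
      rw [← comp_aeval_apply, map_eq_zero_iff ι hι, hy]
    have h2 : (fun (F : MvPolynomial σ K) p => algebraMap R L (aeval y (pderiv p F))) =
        fun F p => aeval (fun p => ι (y p)) (pderiv p F) := by
      ext F p
      rw [← comp_aeval_apply]
      rfl
    rw [Set.image_image, h2]
    exact h1)
  refine ⟨g, hg, fun φ hφ => ?_⟩
  have h1 := H (φ : R →+* K) hφ
  rw [Set.image_image] at h1
  have h2 : (fun (F : MvPolynomial σ K) p => eval (fun i => φ (y i)) (pderiv p F)) =
      fun F p => (φ : R →+* K) (aeval y (pderiv p F)) := by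
    ext F p
    rw [RingHom.coe_coe, comp_aeval_apply, aeval_eq_eval]
  rw [coneTangent_eq_orth, h2]
  exact h1

/-- Generic smoothness of the dominant map (q, w) ↦ `act q w`: its generic differential has rank at
least d, the dimension of the cone over X, and this persists at the general point. -/
theorem exists_le_finrank_incidenceImage (hB : (idealOf (pluecker '' B)).IsPrime)
    (hne : B.Nonempty) {X : Set (ℙ K (Vec K N))} (hXB : X = unionOfLines B)
    (hX : (idealOf X).IsPrime) {d : ℕ} (hXdim : coneDim X = (d : Cardinal)) :
    ∃ g : IncidenceRing B, g ≠ 0 ∧ ∀ (q : PlIdx N → K) (hq : q ∈ coneOf (pluecker '' B)) (w),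
      evalIncidence q (aeval_eq_zero_of_mem_coneOf hq) w g ≠ 0 →
        d ≤ Module.finrank K (incidenceImage B q w) := by
  have := isDomain_incidenceRing hB
  obtain ⟨ξ, ω, g, hg, hξ, H⟩ := exists_linearIndependent_deformations hX hXdim (genericLine B)
    (genericCoord B) fun F => by
      rw [hXB]
      exact aeval_genericVec_eq_zero_iff hB hne F
  refine ⟨g, hg, fun q hq w hw => ?_⟩
  have h1 := H _ hw
  simp only [evalIncidence_genericLine, evalIncidence_genericCoord] at h1
  set φ := evalIncidence q (aeval_eq_zero_of_mem_coneOf hq) w with hφ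
  have h2 : ∀ k, (fun i => ∑ j, (φ (ξ k (i, j)) * w j + q (i, j) * φ (ω k j))) ∈
      incidenceImage B q w := by
    intro k
    refine mem_incidenceImage.mpr ⟨fun p => φ (ξ k p), ?_, fun j => φ (ω k j), ?_⟩
    · rw [mem_coneTangent]
      intro F hF
      have h3 := congrArg φ (hξ k F ((aeval_genericLine_eq_zero_iff F).mpr hF))
      rw [map_sum, map_zero] at h3
      rw [polyDifferential_apply, ← h3]
      refine Finset.sum_congr rfl fun p _ => ?_
      rw [map_mul, comp_aeval_apply, ← aeval_eq_eval]
      simp only [hφ, evalIncidence_genericLine]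
    · ext i
      simp only [Pi.add_apply, act_apply, Finset.sum_add_distrib]
  have h3 : LinearIndependent K fun k => (⟨_, h2 k⟩ : incidenceImage B q w) :=
    LinearIndependent.of_comp (incidenceImage B q w).subtype h1
  simpa using h3.fintype_card_le_finrank

/-- At the general point of the general line of `B`, the tangent spaces to `B` and to the union
`X` have the expected dimension, and the differential of the incidence map is onto the tangent
space to `X`. -/
theorem forGeneral_finrank_tangent (hB : (idealOf (pluecker '' B)).IsPrime) (hne : B.Nonempty)
    {X : Set (ℙ K (Vec K N))} (hXB : X = unionOfLines B) (hX : (idealOf X).IsPrime) {c d : ℕ}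
    (hBdim : coneDim (pluecker '' B) = (c : Cardinal)) (hXdim : coneDim X = (d : Cardinal)) :
    ForGeneral B fun r => ∃ (q : PlIdx N → K) (hq : q ≠ 0),
      pluecker r = Projectivization.mk K q hq ∧
      ∃ G : MvPolynomial (Fin (N + 1)) K, G ≠ 0 ∧ ∀ w, eval w G ≠ 0 → act q w ≠ 0 ∧
        Module.finrank K (coneTangent (pluecker '' B) q) ≤ c ∧
        Module.finrank K (coneTangent X (act q w)) ≤ d ∧
        d ≤ Module.finrank K (incidenceImage B q w) := by
  have := isDomain_incidenceRing hB
  obtain ⟨i, hi⟩ := exists_genericVec_ne_zero hne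
  obtain ⟨g₁, hg₁, H₁⟩ := exists_finrank_coneTangent_le hB hBdim (genericLine B) aeval_genericLine_eq_zero_iff
  obtain ⟨g₂, hg₂, H₂⟩ := exists_finrank_coneTangent_le hX hXdim (genericVec B) fun F => by
    rw [aeval_genericVec_eq_zero_iff hB hne, hXB]
  obtain ⟨g₃, hg₃, H₃⟩ := exists_le_finrank_incidenceImage hB hne hXB hX hXdim
  obtain ⟨P, hP, hg⟩ := exists_polynomial_of_ne_zero
    (mul_ne_zero (mul_ne_zero hi hg₁) (mul_ne_zero hg₂ hg₃))
  refine (forGeneral_eval_ne_zero hP).mono ?_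
  rintro r hr ⟨q, hq0, he, hqP⟩
  have hq : q ∈ coneOf (pluecker '' B) := ⟨hq0, r, hr, he⟩
  obtain ⟨G, hG, hGw⟩ := hg q hq hqP
  refine ⟨q, hq0, he, G, hG, fun w hw => ?_⟩
  rw [← hGw, map_mul, map_mul, map_mul] at hw
  have h1 := H₁ _ (right_ne_zero_of_mul (left_ne_zero_of_mul hw))
  have h2 := H₂ _ (left_ne_zero_of_mul (right_ne_zero_of_mul hw))
  have h3 := H₃ q hq w (right_ne_zero_of_mul (right_ne_zero_of_mul hw))
  have hvec : (fun i => evalIncidence q (aeval_eq_zero_of_mem_coneOf hq) w (genericVec B i)) =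
    act q w := _root_.funext evalIncidence_genericVec
  have hlin : (fun p => evalIncidence q (aeval_eq_zero_of_mem_coneOf hq) w (genericLine B p)) =
    q := _root_.funext evalIncidence_genericLine
  rw [hlin] at h1
  rw [hvec] at h2
  refine ⟨fun h0 => ?_, h1, h2, h3⟩
  apply left_ne_zero_of_mul (left_ne_zero_of_mul hw)
  exact (congrFun hvec i).trans (by rw [h0, Pi.zero_apply])

/-- The general line of `B` is a general line in the above sense. -/
theorem forGeneral_isGeneralLine (hB : (idealOf (pluecker '' B)).IsPrime) (hne : B.Nonempty)
    {X : Set (ℙ K (Vec K N))} (hXB : X = unionOfLines B) (hX : (idealOf X).IsPrime)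
    (hBdim : HasDim (pluecker '' B) n) (hXdim : HasDim X (n + 1)) :
    ForGeneral B (IsGeneralLine n B X) := by
  refine (forGeneral_finrank_tangent hB hne hXB hX hBdim hXdim).mono ?_
  rintro r hr ⟨q, hq0, he, G, hG, hGw⟩
  have key : ∀ w, eval w G ≠ 0 → act q w ≠ 0 ∧
      Module.finrank K (tangentSpace B r) = n ∧
      (∀ η ∈ tangentSpace B r, η ⟨act q w, act_mem he w⟩ = 0 → η = 0) ∧
      Module.finrank K (coneTangent X (act q w)) = n + 2 ∧
      ∀ a, a ∈ coneTangent X (act q w) ↔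
        ∃ η ∈ tangentSpace B r, r.1.mkQ a = η ⟨act q w, act_mem he w⟩ := by
    intro w hw
    obtain ⟨h0, h1, h2, h3⟩ := hGw w hw
    have h4 := finrank_tangentSpace_lt hr he
    have h5 : incidenceImage B q w ≤ coneTangent X (act q w) := by
      rw [hXB]
      exact incidenceImage_le hB ⟨hq0, r, hr, he⟩ w
    have h7 := Submodule.eq_of_le_of_finrank_le h5 (h2.trans h3)
    have h8 := incidenceImage_eq (B := B) he w
    have h3' := h3
    rw [h8] at h3'
    have h3'' := h3
    rw [h7] at h3''
    -- The chain n + 2 ≤ dim (incidence image) = rank + 2 ≤ dim T_rB + 2 ≤ n + 2 closes up. It gives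
    -- both the dimension of T_rB and the injectivity of evaluation.
    have h12 : Module.finrank K (tangentSpace B r) ≤ n := Nat.lt_succ_iff.mp (h4.trans_le h1)
    have h13 : n + 2 ≤ Module.finrank K
      ((LinearMap.range (evalTangent B r ⟨act q w, act_mem he w⟩)).comap r.1.mkQ) := h3'
    obtain ⟨h9, h10⟩ := injective_of_finrank_comap_mkQ (V := Vec K N) (T := tangentSpace B r)
      (S := r.1) (s := 2) (n := n) r.2
      (evalTangent B r ⟨act q w, act_mem he w⟩) h12 h13
    refine ⟨h0, h9, fun η hη hηw => ?_, le_antisymm h2 h3'', fun a => ?_⟩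
    · have : (⟨η, hη⟩ : tangentSpace B r) = 0 := h10 (by rw [map_zero]; exact hηw)
      exact congrArg Subtype.val this
    · rw [← h7, h8, Submodule.mem_comap]
      constructor
      · rintro ⟨η, hη⟩
        exact ⟨η.1, η.2, hη.symm⟩
      · rintro ⟨η, hη, hηa⟩
        exact ⟨⟨η, hη⟩, hηa.symm⟩
  obtain ⟨w₀, hw₀⟩ : ∃ w, eval w G ≠ 0 := by
    by_contra! hall
    exact hG (MvPolynomial.funext fun w => by rw [hall w, map_zero])
  refine ⟨(key w₀ hw₀).2.1, ?_⟩
  have hc : ∀ k, ∃ c, act q c = (lineBasis r k : Vec K N) := fun k => by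
    change (lineBasis r k : Vec K N) ∈ LinearMap.range (act q)
    rw [range_act he]
    exact (lineBasis r k).2
  choose c hc using hc
  let a : Fin 2 → K := (lineBasis r).repr ⟨act q w₀, act_mem he w₀⟩
  have ha : act q w₀ = ∑ k, a k • (lineBasis r k : Vec K N) := by
    have := congrArg Subtype.val ((lineBasis r).sum_repr ⟨act q w₀, act_mem he w₀⟩)
    refine this.symm.trans ?_
    rw [Submodule.coe_sum]
    rfl
  -- G is a polynomial in w, but the claim concerns coordinates x on r̂. This affine section
  -- satisfies `act q (w x) = lineVec r x` and passes through w₀ at x = a, so the pullback of G is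
  -- still nonzero.
  let w : (Fin 2 → K) → Vec K N := fun x => w₀ + ∑ k, (x k - a k) • c k
  have hw : ∀ x, (⟨act q (w x), act_mem he (w x)⟩ : r.1) = lineVec r x := by
    intro x
    ext1
    simp only [w, map_add, map_sub, map_sum, map_smul, hc, ha, lineVec, Submodule.coe_sum,
      Submodule.coe_smul, sub_smul, Finset.sum_sub_distrib]
    abel
  have hw' : ∀ x, act q (w x) = lineVec r x := fun x => congrArg Subtype.val (hw x)
  let P : MvPolynomial (Fin 2) K := bind₁ (fun i => C (w₀ i) +
    ∑ k, (MvPolynomial.X k - C (a k)) * C (c k i)) G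
  have hP : ∀ x, eval x P = eval (w x) G := by
    intro x
    rw [← aeval_eq_eval, ← aeval_eq_eval, aeval_bind₁]
    congr 2
    ext i
    simp [w]
  refine ⟨P, fun h0 => ?_, fun x hx => ?_⟩
  · have h1 := hP a
    rw [h0, map_zero] at h1
    apply hw₀
    rw [h1]
    congr 2
    simp [w]
  · rw [hP] at hx
    obtain ⟨h0, -, h1, h2, h3⟩ := key _ hx
    rw [hw'] at h0 h2
    rw [hw] at h1
    simp only [hw'] at h3
    exact ⟨h0, h1, h2, h3⟩

end GeneralLine

end FocalLines

namespace FocalLines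

/-! ### Binary forms and schemes of finite length on the projective line -/

section BinaryForms

open MvPolynomial

variable {K : Type*} [Field K]

/-- Binary monomials of degree `e` are determined by the exponent of the first variable. -/
def degreeEquivFin (e : ℕ) : {d : Fin 2 →₀ ℕ | d.degree = e} ≃ Fin (e + 1) where
  toFun d := ⟨d.1 0, by
    have h := d.2
    rw [Set.mem_ofPred_eq, Finsupp.degree_eq_sum, Fin.sum_univ_two] at h
    omega⟩
  invFun i := ⟨Finsupp.single 0 i.1 + Finsupp.single 1 (e - i.1), by
    have := i.2
    rw [Set.mem_ofPred_eq, Finsupp.degree_eq_sum, Fin.sum_univ_two]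
    simp
    omega⟩
  left_inv d := by
    have h := d.2
    rw [Set.mem_ofPred_eq, Finsupp.degree_eq_sum, Fin.sum_univ_two] at h
    ext i
    fin_cases i
    · simp
    · simp
      omega
  right_inv i := by
    ext
    simp

/-- Binary forms of degree `e`, in terms of their coefficients. -/
def homogeneousEquiv (K : Type*) [Field K] (e : ℕ) :
    homogeneousSubmodule (Fin 2) K e ≃ₗ[K] (Fin (e + 1) →₀ K) :=
  (LinearEquiv.ofEq _ _ (homogeneousSubmodule_eq_finsupp_supported (Fin 2) K e)).trans
    ((AddMonoidAlgebra.supportedEquivFinsupp _).trans (Finsupp.domLCongr (degreeEquivFin e)))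

theorem finrank_homogeneousSubmodule (e : ℕ) :
    Module.finrank K (homogeneousSubmodule (Fin 2) K e) = e + 1 := by
  rw [(homogeneousEquiv K e).finrank_eq, Module.finrank_finsupp_self, Fintype.card_fin]

instance (e : ℕ) : Module.Finite K (homogeneousSubmodule (Fin 2) K e) :=
  Module.Finite.equiv (homogeneousEquiv K e).symm

/-- Multiplication by a form of degree `n`. -/
def mulForm {n : ℕ} (F : MvPolynomial (Fin 2) K) (hF : F.IsHomogeneous n) {m e : ℕ}
    (h : n + m = e) :
    homogeneousSubmodule (Fin 2) K m →ₗ[K] homogeneousSubmodule (Fin 2) K e :=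
  (LinearMap.mulLeft K F).restrict fun a ha => by
    rw [mem_homogeneousSubmodule] at ha ⊢
    exact h ▸ hF.mul ha

theorem coe_mulForm {n : ℕ} {F : MvPolynomial (Fin 2) K} (hF : F.IsHomogeneous n) {m e : ℕ}
    (h : n + m = e) (a : homogeneousSubmodule (Fin 2) K m) :
    (mulForm F hF h a : MvPolynomial (Fin 2) K) = F * a := rfl

theorem mulForm_injective {n : ℕ} {F : MvPolynomial (Fin 2) K} (hF : F.IsHomogeneous n)
    (hF0 : F ≠ 0) {m e : ℕ} (h : n + m = e) : Function.Injective (mulForm F hF h) := by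
  intro a b hab
  have h1 : F * (a : MvPolynomial (Fin 2) K) = F * b := congrArg Subtype.val hab
  exact Subtype.ext (mul_left_cancel₀ hF0 h1)

theorem finrank_range_mulForm {n : ℕ} {F : MvPolynomial (Fin 2) K} (hF : F.IsHomogeneous n)
    (hF0 : F ≠ 0) {m e : ℕ} (h : n + m = e) :
    Module.finrank K (LinearMap.range (mulForm F hF h)) = m + 1 := by
  rw [LinearMap.finrank_range_of_inj (mulForm_injective hF hF0 h), finrank_homogeneousSubmodule]

theorem homogeneousComponent_mul_of_isHomogeneous {n m : ℕ} {F : MvPolynomial (Fin 2) K}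
    (hF : F.IsHomogeneous n) (c : MvPolynomial (Fin 2) K) :
    homogeneousComponent (n + m) (F * c) = F * homogeneousComponent m c := by
  conv_lhs => rw [← sum_homogeneousComponent c]
  rw [Finset.mul_sum, map_sum]
  have h1 : ∀ i, homogeneousComponent (n + m) (F * homogeneousComponent i c) =
      if i = m then F * homogeneousComponent i c else 0 := by
    intro i
    rw [homogeneousComponent_of_mem (hF.mul (homogeneousComponent_isHomogeneous i c))]
    simp [eq_comm]
  simp only [h1, Finset.sum_ite_eq', Finset.mem_range]
  split_ifs with h
  · rfl
  · rw [homogeneousComponent_eq_zero _ _ (by omega), mul_zero]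

/-- The degree `e` part of an ideal. -/
abbrev degreePart (J : Ideal (MvPolynomial (Fin 2) K)) (e : ℕ) :
    Submodule K (homogeneousSubmodule (Fin 2) K e) :=
  (J.restrictScalars K).comap (homogeneousSubmodule (Fin 2) K e).subtype

theorem range_mulForm_le {n : ℕ} {F : MvPolynomial (Fin 2) K} (hF : F.IsHomogeneous n)
    {J : Ideal (MvPolynomial (Fin 2) K)} (hFJ : F ∈ J) {m e : ℕ} (h : n + m = e) :
    LinearMap.range (mulForm F hF h) ≤ degreePart J e := by
  rintro _ ⟨a, rfl⟩
  exact J.mul_mem_right _ hFJ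

/-- The subscheme of `ℙ¹` defined by a form of degree `n` has length `n`. -/
theorem hasLength_span_singleton {n : ℕ} {F : MvPolynomial (Fin 2) K} (hF : F.IsHomogeneous n)
    (hF0 : F ≠ 0) : HasLength (Ideal.span {F}) n := by
  filter_upwards [Filter.eventually_ge_atTop n] with e he
  obtain ⟨m, rfl⟩ := Nat.exists_eq_add_of_le he
  have h1 : LinearMap.range (mulForm F hF rfl) = degreePart (Ideal.span {F}) (n + m) := by
    refine le_antisymm (range_mulForm_le hF (Ideal.mem_span_singleton_self F) rfl) ?_
    rintro ⟨a, ha⟩ haJ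
    obtain ⟨c, hc⟩ := Ideal.mem_span_singleton.mp (show a ∈ Ideal.span {F} from haJ)
    refine ⟨⟨homogeneousComponent m c, homogeneousComponent_isHomogeneous m c⟩, ?_⟩
    ext1
    rw [coe_mulForm]
    change F * homogeneousComponent m c = a
    rw [← homogeneousComponent_mul_of_isHomogeneous hF, ← hc]
    exact homogeneousComponent_eq_self ha
  have h2 := finrank_range_mulForm (K := K) hF hF0 (rfl : n + m = n + m)
  have h3 := Submodule.finrank_quotient_add_finrank (degreePart (Ideal.span {F}) (n + m))
  rw [finrank_homogeneousSubmodule, ← h1, h2, h1] at h3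
  change Module.finrank K (_ ⧸ degreePart (Ideal.span {F}) (n + m)) = n
  omega

/-- If an ideal contains a non-zero form `F` of degree `n` and defines a scheme of length `n`,
then all its forms of degree `n` are multiples of `F`. -/
theorem HasLength.exists_eq_smul [IsAlgClosed K] {n : ℕ} {F G : MvPolynomial (Fin 2) K}
    {J : Ideal (MvPolynomial (Fin 2) K)} (hJ : HasLength J n) (hF : F.IsHomogeneous n)
    (hF0 : F ≠ 0) (hFJ : F ∈ J) (hG : G.IsHomogeneous n) (hGJ : G ∈ J) : ∃ c : K, G = c • F := by
  obtain ⟨e, he, hne⟩ := (hJ.and (Filter.eventually_ge_atTop n)).exists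
  obtain ⟨m, rfl⟩ := Nat.exists_eq_add_of_le hne
  have h2 := finrank_range_mulForm (K := K) hF hF0 (rfl : n + m = n + m)
  have h3 := Submodule.finrank_quotient_add_finrank (degreePart J (n + m))
  rw [finrank_homogeneousSubmodule, he] at h3
  have h1 : LinearMap.range (mulForm F hF rfl) = degreePart J (n + m) :=
    Submodule.eq_of_le_of_finrank_le (range_mulForm_le hF hFJ rfl) (by omega)
  -- By dimension, the degree n + m part of J is F times the forms of degree m, so multiplication by
  -- G/F is an endomorphism T of those forms. An eigenvector a of T satisfies G a = c F a, whence G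
  -- = c F.
  let E := LinearEquiv.ofInjective (mulForm F hF (rfl : n + m = n + m))
    (mulForm_injective hF hF0 rfl)
  let T : Module.End K (homogeneousSubmodule (Fin 2) K m) :=
    E.symm.toLinearMap ∘ₗ (mulForm G hG (rfl : n + m = n + m)).codRestrict
      (LinearMap.range (mulForm F hF (rfl : n + m = n + m)))
      fun a => h1 ▸ range_mulForm_le hG hGJ rfl ⟨a, rfl⟩
  have hT : ∀ a, F * (T a : MvPolynomial (Fin 2) K) = G * a := by
    intro a
    have h4 : E (T a) = (mulForm G hG (rfl : n + m = n + m)).codRestrict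
      (LinearMap.range (mulForm F hF (rfl : n + m = n + m)))
      (fun a => h1 ▸ range_mulForm_le hG hGJ rfl ⟨a, rfl⟩) a := E.apply_symm_apply _
    exact congrArg (fun x => (x.1.1 : MvPolynomial (Fin 2) K)) h4
  have : Nontrivial (homogeneousSubmodule (Fin 2) K m) := by
    apply Module.nontrivial_of_finrank_pos (R := K)
    rw [finrank_homogeneousSubmodule]
    omega
  obtain ⟨c, hc⟩ := Module.End.exists_eigenvalue T
  obtain ⟨a, ha⟩ := hc.exists_hasEigenvector
  refine ⟨c, ?_⟩
  have ha0 : (a : MvPolynomial (Fin 2) K) ≠ 0 := fun h => ha.2 (Subtype.ext h)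
  apply mul_right_cancel₀ ha0
  rw [← hT a, ha.apply_eq_smul]
  simp

end BinaryForms

end FocalLines

namespace FocalLines

/-! ### Pencils of linear maps and their maximal minors -/

section Pencils

open MvPolynomial

variable {K T W : Type*} [Field K] [AddCommMonoid T] [Module K T] [AddCommGroup W] [Module K W]

/-- The linear form `x ↦ l (φ x η)` in the coordinates of the plane `K²`. -/
def pencilEntry (φ : (Fin 2 → K) →ₗ[K] T →ₗ[K] W) (l : Module.Dual K W) (η : T) :
    MvPolynomial (Fin 2) K :=
  ∑ k, C (l (φ (Pi.single k 1) η)) * X k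

/-- The maximal minors of a pencil of linear maps. -/
def pencilMinor (φ : (Fin 2 → K) →ₗ[K] T →ₗ[K] W) {n : ℕ} (l : Fin n → Module.Dual K W)
    (η : Fin n → T) : MvPolynomial (Fin 2) K :=
  (Matrix.of fun i j => pencilEntry φ (l i) (η j)).det

/-- The ideal generated by the minors of order `n` of a pencil of linear maps. -/
def pencilIdeal (φ : (Fin 2 → K) →ₗ[K] T →ₗ[K] W) (n : ℕ) : Ideal (MvPolynomial (Fin 2) K) :=
  Ideal.span {F | ∃ (l : Fin n → Module.Dual K W) (η : Fin n → T), F = pencilMinor φ l η}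

variable (φ : (Fin 2 → K) →ₗ[K] T →ₗ[K] W)

theorem eval_pencilEntry (l : Module.Dual K W) (η : T) (x : Fin 2 → K) :
    eval x (pencilEntry φ l η) = l (φ x η) := by
  have hx : x = ∑ k, x k • (Pi.single k 1 : Fin 2 → K) := by
    ext i
    fin_cases i <;> simp
  conv_rhs => rw [hx]
  simp only [pencilEntry, map_sum, map_mul, eval_C, eval_X, map_smul, LinearMap.sum_apply,
    LinearMap.smul_apply, smul_eq_mul, mul_comm]

theorem eval_pencilMinor {n : ℕ} (l : Fin n → Module.Dual K W) (η : Fin n → T)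
    (x : Fin 2 → K) :
    eval x (pencilMinor φ l η) = (Matrix.of fun i j => l i (φ x (η j))).det := by
  rw [pencilMinor, RingHom.map_det]
  congr 1
  ext i j
  simp [eval_pencilEntry]

theorem isHomogeneous_pencilMinor {n : ℕ} (l : Fin n → Module.Dual K W) (η : Fin n → T) :
    (pencilMinor φ l η).IsHomogeneous n := by
  rw [pencilMinor, Matrix.det_apply]
  refine IsHomogeneous.sum _ _ _ fun σ _ => ?_
  have h1 : (∏ i, (Matrix.of fun i j => pencilEntry φ (l i) (η j)) (σ i) i).IsHomogeneous n := by
    have h2 := IsHomogeneous.prod Finset.univ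
      (fun i => (Matrix.of fun i j => pencilEntry φ (l i) (η j)) (σ i) i) (fun _ => 1)
      fun i _ => by
        rw [Matrix.of_apply, pencilEntry]
        refine IsHomogeneous.sum _ _ _ fun k _ => ?_
        simpa using (isHomogeneous_C (Fin 2) _).mul (isHomogeneous_X K k)
    simpa using h2
  rw [← mem_homogeneousSubmodule] at h1 ⊢
  rw [Units.smul_def]
  exact zsmul_mem h1 _

/-- A frame adapted to an injective member of a pencil. -/
theorem exists_frame {n : ℕ} {x₀ : Fin 2 → K} (hinj : Function.Injective (φ x₀))
    (hn : Module.finrank K (LinearMap.range (φ x₀)) = n) [FiniteDimensional K W] :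
    ∃ (η : Fin n → T) (l : Fin n → Module.Dual K W),
      (∀ i j, l i (φ x₀ (η j)) = if i = j then 1 else 0) ∧
      (∀ w ∈ LinearMap.range (φ x₀), w = ∑ m, l m w • φ x₀ (η m)) ∧
      ∀ θ : T, θ = ∑ m, l m (φ x₀ θ) • η m := by
  let e := Module.finBasisOfFinrankEq K (LinearMap.range (φ x₀)) hn
  choose η hη using fun j => (e j).2
  choose l hl using fun i => LinearMap.exists_extend (e.coord i)
  have hl' : ∀ i (w : LinearMap.range (φ x₀)), l i w = e.repr w i := fun i w =>
    LinearMap.congr_fun (hl i) w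
  have hw : ∀ w ∈ LinearMap.range (φ x₀), w = ∑ m, l m w • φ x₀ (η m) := by
    intro w hw
    have h := congrArg Subtype.val (e.sum_repr ⟨w, hw⟩)
    simp only [AddSubmonoidClass.coe_finsetSum, Submodule.coe_smul] at h
    rw [← h]
    conv_rhs => rw [h]
    exact Finset.sum_congr rfl fun m _ => by rw [hη, ← hl' m ⟨w, hw⟩]
  refine ⟨η, l, ?_, hw, fun θ => hinj ?_⟩
  · intro i j
    rw [hη, hl', e.repr_self, Finsupp.single_apply]
    simp [eq_comm]
  · rw [map_sum]
    simp only [map_smul]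
    exact hw _ ⟨θ, rfl⟩

/-- The pencil is in effect an n × n matrix of linear forms with values in the fixed space im
φ_{x₀}, so its maximal minors all equal its determinant up to constants. -/
theorem hasLength_pencilIdeal_of_range_le [Infinite K] [FiniteDimensional K W] {n : ℕ}
    {x₀ : Fin 2 → K} (hinj : Function.Injective (φ x₀))
    (hn : Module.finrank K (LinearMap.range (φ x₀)) = n)
    (h : ∀ x, LinearMap.range (φ x) ≤ LinearMap.range (φ x₀)) :
    HasLength (pencilIdeal φ n) n := by
  obtain ⟨η, l, hδ, hw, hθ⟩ := exists_frame φ hinj hn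
  have hF0 : pencilMinor φ l η ≠ 0 := by
    intro h0
    have h1 := eval_pencilMinor φ l η x₀
    rw [h0, map_zero] at h1
    have h2 : (Matrix.of fun i j => l i (φ x₀ (η j))) = 1 := by
      ext i j
      rw [Matrix.of_apply, hδ, Matrix.one_apply]
    rw [h2, Matrix.det_one] at h1
    exact zero_ne_one h1
  have hJ : pencilIdeal φ n = Ideal.span {pencilMinor φ l η} := by
    refine le_antisymm (Ideal.span_le.mpr ?_) (Ideal.span_mono ?_)
    · rintro _ ⟨l', η', rfl⟩
      -- Expanding source vectors and values in the frame factors the matrix of the minor as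
      -- (constant) · (frame matrix at x) · (constant); the determinants multiply.
      refine Ideal.mem_span_singleton'.mpr
        ⟨C ((Matrix.of fun i m => l' i (φ x₀ (η m))).det *
          (Matrix.of fun k j => l k (φ x₀ (η' j))).det), MvPolynomial.funext fun x => ?_⟩
      rw [map_mul, eval_C, eval_pencilMinor, eval_pencilMinor, mul_right_comm, ← Matrix.det_mul,
        ← Matrix.det_mul]
      congr 1
      ext i j
      simp only [Matrix.mul_apply, Matrix.of_apply]
      conv_rhs => rw [hθ (η' j), map_sum, map_sum]
      refine Finset.sum_congr rfl fun k _ => ?_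
      conv_rhs => rw [map_smul, hw (φ x (η k)) (h x ⟨_, rfl⟩)]
      simp [mul_comm]
    · rintro _ rfl
      exact ⟨l, η, rfl⟩
  rw [hJ]
  exact hasLength_span_singleton (isHomogeneous_pencilMinor φ l η) hF0

/-- Length n makes the frame minor F the only minor up to scalars. A functional f that kills im
φ_{x₀} must then kill every image, as a test by modified minors shows. -/
theorem range_le_of_hasLength_pencilIdeal [IsAlgClosed K] [FiniteDimensional K W] {n : ℕ}
    {x₀ : Fin 2 → K} (hinj : Function.Injective (φ x₀))
    (hn : Module.finrank K (LinearMap.range (φ x₀)) = n)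
    (h : HasLength (pencilIdeal φ n) n) (x : Fin 2 → K) :
    LinearMap.range (φ x) ≤ LinearMap.range (φ x₀) := by
  have : Infinite K := IsAlgClosed.instInfinite
  obtain ⟨η, l, hδ, hw, hθ⟩ := exists_frame φ hinj hn
  have hF1 : eval x₀ (pencilMinor φ l η) = 1 := by
    rw [eval_pencilMinor]
    have h2 : (Matrix.of fun i j => l i (φ x₀ (η j))) = 1 := by
      ext i j
      rw [Matrix.of_apply, hδ, Matrix.one_apply]
    rw [h2, Matrix.det_one]
  have hF0 : pencilMinor φ l η ≠ 0 := by
    intro h0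
    rw [h0, map_zero] at hF1
    exact zero_ne_one hF1
  have key : ∀ f : Module.Dual K W, (∀ w ∈ LinearMap.range (φ x₀), f w = 0) →
      ∀ j y, f (φ y (η j)) = 0 := by
    intro f hf j
    -- This minor is c F; at x₀ it has a zero row while F(x₀) = 1, so c = 0.
    have hM : ∀ m, pencilMinor φ (Function.update l m f) η = 0 := by
      intro m
      obtain ⟨c, hc⟩ := HasLength.exists_eq_smul h (isHomogeneous_pencilMinor φ l η) hF0
        (Ideal.subset_span ⟨l, η, rfl⟩) (isHomogeneous_pencilMinor φ (Function.update l m f) η)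
        (Ideal.subset_span ⟨_, η, rfl⟩)
      have h1 := congrArg (eval x₀) hc
      rw [smul_eval, hF1, mul_one, eval_pencilMinor, Matrix.det_eq_zero_of_row_eq_zero m] at h1
      · rw [hc, ← h1, zero_smul]
      · intro j
        simp [hf]
    -- Cramer's rule for the transposed frame matrix: F times the row of f is a combination of frame
    -- rows whose coefficients are the modified minors, all zero.
    have hz : pencilMinor φ l η * pencilEntry φ f (η j) = 0 := by
      refine MvPolynomial.funext fun y => ?_
      rw [map_mul, map_zero, eval_pencilMinor, eval_pencilEntry]
      set A := Matrix.of fun i j => l i (φ y (η j))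
      have h2 : Matrix.cramer A.transpose (fun j => f (φ y (η j))) = 0 := by
        ext m
        rw [Matrix.cramer_transpose_apply, Pi.zero_apply, ← map_zero (eval y), ← hM m,
          eval_pencilMinor]
        congr 1
        ext i k
        rw [Matrix.updateRow_apply, Matrix.of_apply, Function.update_apply]
        split_ifs <;> rfl
      have h3 := Matrix.mulVec_cramer A.transpose (fun j => f (φ y (η j)))
      rw [h2, Matrix.mulVec_zero, Matrix.det_transpose] at h3
      exact (congrFun h3 j).symm
    have h0 := (mul_eq_zero.mp hz).resolve_left hF0
    intro y
    rw [← eval_pencilEntry, h0, map_zero]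
  rintro _ ⟨θ, rfl⟩
  by_contra hne
  obtain ⟨f, hf, hfS⟩ := Submodule.exists_le_ker_of_notMem hne
  apply hf
  rw [hθ θ, map_sum, map_sum]
  refine Finset.sum_eq_zero fun m _ => ?_
  rw [map_smul, map_smul, key f (fun w hw => hfS hw) m x, smul_zero]

end Pencils

end FocalLines

namespace FocalLines

/-! ### The characteristic map as a pencil -/

section FocalPencil

open MvPolynomial

variable {K : Type*} [Field K] {N : ℕ}

/-- The characteristic map relative to `r`, as a pencil of linear maps. -/
def focalPencil (B : Set (Line K N)) (r : Line K N) :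
    (Fin 2 → K) →ₗ[K] tangentSpace B r →ₗ[K] Vec K N ⧸ r.1 :=
  -((tangentSpace B r).subtype.flip ∘ₗ (lineBasis r).equivFun.symm.toLinearMap)

theorem focalPencil_apply (B : Set (Line K N)) (r : Line K N) (x : Fin 2 → K)
    (η : tangentSpace B r) :
    focalPencil B r x η = -((η : r.1 →ₗ[K] Vec K N ⧸ r.1) (lineVec r x)) := by
  simp only [focalPencil, LinearMap.neg_apply, LinearMap.comp_apply, LinearEquiv.coe_coe,
    LinearMap.flip_apply, Module.Basis.equivFun_symm_apply, lineVec, Submodule.subtype_apply]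

theorem characteristicEntry_eq (B : Set (Line K N)) (r : Line K N)
    (l : Module.Dual K (Vec K N ⧸ r.1)) (η : tangentSpace B r) :
    characteristicEntry B r l η = pencilEntry (focalPencil B r) l η := by
  refine Finset.sum_congr rfl fun k _ => ?_
  have h : lineVec r (Pi.single k 1) = lineBasis r k := by
    rw [lineVec, Finset.sum_eq_single k (fun j _ hj => by rw [Pi.single_eq_of_ne hj, zero_smul])
      (by simp), Pi.single_eq_same, one_smul]
  rw [characteristicMap_apply, focalPencil_apply, h]
  rfl

theorem focalIdeal_eq (B : Set (Line K N)) (r : Line K N) {n : ℕ} (h : maxRank B r = n) :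
    focalIdeal B r = pencilIdeal (focalPencil B r) n := by
  subst h
  simp only [focalIdeal, pencilIdeal, pencilMinor, characteristicEntry_eq]

theorem focalPencil_injective {B : Set (Line K N)} {r : Line K N} {x : Fin 2 → K}
    (h : ∀ η ∈ tangentSpace B r, η (lineVec r x) = 0 → η = 0) :
    Function.Injective (focalPencil B r x) := by
  intro η η' hη
  rw [focalPencil_apply, focalPencil_apply, neg_inj] at hη
  refine Subtype.ext (sub_eq_zero.mp (h _ (Submodule.sub_mem _ η.2 η'.2) ?_))
  rw [LinearMap.sub_apply, hη, sub_self]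

theorem mem_range_focalPencil {B : Set (Line K N)} {r : Line K N} {x : Fin 2 → K}
    {w : Vec K N ⧸ r.1} : w ∈ LinearMap.range (focalPencil B r x) ↔
      ∃ η ∈ tangentSpace B r, w = η (lineVec r x) := by
  constructor
  · rintro ⟨η, rfl⟩
    refine ⟨-η.1, Submodule.neg_mem _ η.2, ?_⟩
    rw [focalPencil_apply, LinearMap.neg_apply]
  · rintro ⟨η, hη, rfl⟩
    refine ⟨⟨-η, Submodule.neg_mem _ hη⟩, ?_⟩
    rw [focalPencil_apply, LinearMap.neg_apply, neg_neg]

theorem eq_zero_of_forall_eval [Infinite K] {σ : Type*} {G D : MvPolynomial σ K} (hG : G ≠ 0)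
    (h : ∀ x, eval x G ≠ 0 → eval x D = 0) : D = 0 := by
  have h1 : G * D = 0 := MvPolynomial.funext fun x => by
    rw [map_mul, map_zero]
    by_cases hx : eval x G = 0
    · rw [hx, zero_mul]
    · rw [h x hx, mul_zero]
  exact (mul_eq_zero.mp h1).resolve_left hG

theorem exists_eval_ne_zero [Infinite K] {σ : Type*} {G : MvPolynomial σ K} (hG : G ≠ 0) :
    ∃ x, eval x G ≠ 0 := by
  by_contra! h
  exact hG (MvPolynomial.funext fun x => by rw [h, map_zero])

/-- A linear space tangent along general points of a line is tangent along the line. -/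
theorem le_coneTangent_of_forall_eval [Infinite K] {X : Set (ℙ K (Vec K N))} {r : Line K N}
    {P : Submodule K (Vec K N)} {G : MvPolynomial (Fin 2) K} (hG : G ≠ 0)
    (h : ∀ x, eval x G ≠ 0 → P ≤ coneTangent X (lineVec r x : Vec K N)) {v : Vec K N}
    (hv : v ∈ r.1) : P ≤ coneTangent X v := by
  intro a ha
  rw [mem_coneTangent]
  intro F hF
  let g : Fin (N + 1) → MvPolynomial (Fin 2) K := fun i =>
    ∑ k, MvPolynomial.X k * C ((lineBasis r k : Vec K N) i)
  have hg : ∀ x, (fun i => eval x (g i)) = (lineVec r x : Vec K N) := by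
    intro x
    ext i
    simp [g, lineVec]
  have hD : ∀ x, eval x (∑ i, aeval g (pderiv i F) * C (a i)) =
      polyDifferential F (lineVec r x : Vec K N) a := by
    intro x
    rw [polyDifferential_apply, map_sum]
    refine Finset.sum_congr rfl fun i _ => ?_
    rw [map_mul, eval_C, ← hg x]
    congr 1
    rw [← coe_aeval_eq_eval, RingHom.coe_coe, comp_aeval_apply, aeval_eq_eval]
  have hD0 := eq_zero_of_forall_eval hG fun x hx => by
    rw [hD x]
    exact (mem_coneTangent.mp (h x hx ha)) F hF
  obtain ⟨x, hx⟩ := (lineBasis r).equivFun.symm.surjective ⟨v, hv⟩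
  have hx' : (lineVec r x : Vec K N) = v := by
    rw [lineVec, ← Module.Basis.equivFun_symm_apply, hx]
  rw [← hx', ← hD x, hD0, map_zero]

end FocalPencil

/-! ### Focal length and constant tangent space on a general line -/

section GeneralLines

open MvPolynomial

variable {K : Type*} [Field K] {n N : ℕ} {B : Set (Line K N)}
  {X : Set (ℙ K (Vec K N))} {r : Line K N}

/-- The target has dimension N − 1 > n, so maximal rank means injectivity and the relevant minors
have order n. -/
theorem IsGeneralLine.maxRank_eq (h : IsGeneralLine n B X r) (hn : n + 2 ≤ N) :
    maxRank B r = n := by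
  have h1 := Submodule.finrank_quotient_add_finrank r.1
  rw [r.2, Module.finrank_fintype_fun_eq_card, Fintype.card_fin] at h1
  rw [maxRank, h.finrank_tangentSpace]
  omega

/-- At general points of r the tangent space is the preimage of the image of the pencil, so a common
P amounts to a constant image. Stating it as an inclusion at every v in r̂ includes the singular
points. -/
theorem IsGeneralLine.hasLength_iff [IsAlgClosed K] (h : IsGeneralLine n B X r) (hn : n + 2 ≤ N) :
    HasLength (focalIdeal B r) n ↔
      ∃ P : Submodule K (Vec K N), Module.finrank K P = n + 2 ∧
        ∀ v ∈ r.1, P ≤ coneTangent X v := by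
  have : Infinite K := IsAlgClosed.instInfinite
  rw [focalIdeal_eq B r (h.maxRank_eq hn)]
  obtain ⟨G, hG, hgood⟩ := h.exists_polynomial
  obtain ⟨x₀, hx₀⟩ := exists_eval_ne_zero hG
  have hinj := focalPencil_injective (hgood x₀ hx₀).2.1
  have hrank : Module.finrank K (LinearMap.range (focalPencil B r x₀)) = n := by
    rw [LinearMap.finrank_range_of_inj hinj, h.finrank_tangentSpace]
  have hmem : ∀ x, eval x G ≠ 0 → ∀ a, a ∈ coneTangent X (lineVec r x : Vec K N) ↔
      r.1.mkQ a ∈ LinearMap.range (focalPencil B r x) := fun x hx a => by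
    rw [mem_range_focalPencil, (hgood x hx).2.2.2]
  constructor
  · intro hJ
    refine ⟨_, (hgood x₀ hx₀).2.2.1, fun v hv => le_coneTangent_of_forall_eval hG ?_ hv⟩
    intro x hx
    refine (Submodule.eq_of_le_of_finrank_eq ?_ ?_).ge
    · intro a ha
      rw [hmem x₀ hx₀]
      exact range_le_of_hasLength_pencilIdeal _ hinj hrank hJ x ((hmem x hx a).mp ha)
    · rw [(hgood x hx).2.2.1, (hgood x₀ hx₀).2.2.1]
  · rintro ⟨P, hP, hPle⟩
    refine hasLength_pencilIdeal_of_range_le _ hinj hrank fun x => ?_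
    have hPeq : ∀ x, eval x G ≠ 0 → P = coneTangent X (lineVec r x : Vec K N) := fun x hx =>
      Submodule.eq_of_le_of_finrank_eq (hPle _ (lineVec r x).2) (by rw [hP, (hgood x hx).2.2.1])
    rintro _ ⟨θ, rfl⟩
    by_contra hne
    obtain ⟨f, hf, hfS⟩ := Submodule.exists_le_ker_of_notMem hne
    apply hf
    -- The images agree with im φ_{x₀} only at general y; since f(φ_y θ) is polynomial in y, its
    -- vanishing there extends to all y, including x.
    have h0 : pencilEntry (focalPencil B r) f θ = 0 := eq_zero_of_forall_eval hG fun y hy => ?_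
    · rw [← eval_pencilEntry, h0, map_zero]
    rw [eval_pencilEntry]
    refine hfS ?_
    obtain ⟨a, ha⟩ := r.1.mkQ_surjective (focalPencil B r y θ)
    rw [← ha, ← hmem x₀ hx₀, ← hPeq x₀ hx₀, hPeq y hy, hmem y hy, ha]
    exact ⟨θ, rfl⟩

/-- General points of r are nonsingular on X, and containing P is a closed condition along r.
Conversely, at a nonsingular point the inclusion of P is an equality by dimension. -/
theorem IsGeneralLine.constantTangentAlong_iff [IsAlgClosed K] (h : IsGeneralLine n B X r) (hr : r ∈ B)
    (hXB : X = unionOfLines B) (hXdim : HasDim X (n + 1)) :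
    ConstantTangentAlong X r ↔
      ∃ P : Submodule K (Vec K N), Module.finrank K P = n + 2 ∧
        ∀ v ∈ r.1, P ≤ coneTangent X v := by
  have : Infinite K := IsAlgClosed.instInfinite
  constructor
  · rintro ⟨P, hP⟩
    obtain ⟨G, hG, hgood⟩ := h.exists_polynomial
    have key : ∀ x, eval x G ≠ 0 → coneTangent X (lineVec r x : Vec K N) = P := by
      intro x hx
      obtain ⟨hv, -, hdim, -⟩ := hgood x hx
      have hsub : (Projectivization.mk K (lineVec r x : Vec K N) hv).submodule ≤ r.1 := by
        rw [Projectivization.submodule_mk, Submodule.span_singleton_le_iff_mem]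
        exact (lineVec r x).2
      rw [← embTangent_mk X _ hv]
      refine hP _ hsub ⟨?_, ?_⟩
      · rw [hXB]
        exact ⟨r, hr, hsub⟩
      · rw [embTangent_mk, hdim, hXdim]
    obtain ⟨x₀, hx₀⟩ := exists_eval_ne_zero hG
    refine ⟨P, ?_, fun v hv => le_coneTangent_of_forall_eval hG (fun x hx => (key x hx).ge) hv⟩
    rw [← key x₀ hx₀]
    exact (hgood x₀ hx₀).2.2.1
  · rintro ⟨P, hP, hPle⟩
    refine ⟨P, fun x hx hns => (Submodule.eq_of_le_of_finrank_eq (hPle x.rep ?_) ?_).symm⟩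
    · rwa [Projectivization.submodule_eq, Submodule.span_singleton_le_iff_mem] at hx
    · have h1 := hns.2
      rw [hXdim, Nat.cast_inj] at h1
      rw [hP]
      exact h1.symm

theorem IsGeneralLine.hasLength_iff_constantTangentAlong [IsAlgClosed K] (h : IsGeneralLine n B X r)
    (hn : n + 2 ≤ N) (hr : r ∈ B) (hXB : X = unionOfLines B) (hXdim : HasDim X (n + 1)) :
    HasLength (focalIdeal B r) n ↔ ConstantTangentAlong X r := by
  rw [h.hasLength_iff hn, h.constantTangentAlong_iff hr hXB hXdim]

end GeneralLines

end FocalLines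

/-! ### From the general line to every line -/

namespace FocalLines

open MvPolynomial

/-- Linear independence of vectors depending polynomially on parameters is an open condition. -/
theorem exists_eval_ne_zero_imp_linearIndependent {K τ κ m : Type*} [Field K] [Fintype κ]
    [Fintype m] (s : κ → m → MvPolynomial τ K) (q : τ → K)
    (hs : LinearIndependent K fun k i => eval q (s k i)) :
    ∃ D : MvPolynomial τ K, eval q D ≠ 0 ∧ ∀ q', eval q' D ≠ 0 →
      LinearIndependent K fun k i => eval q' (s k i) := by
  classical
  obtain ⟨l, hl⟩ := LinearMap.exists_leftInverse_of_injective
    (Fintype.linearCombination K fun k i => eval q (s k i))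
    (LinearMap.ker_eq_bot.mpr (linearIndependent_iff_injective_fintypeLinearCombination.mp hs))
  -- H is a right inverse of the matrix S at q, so D = det (S · H) is 1 at q, and D ≠ 0 forces the
  -- rows of S to be independent.
  let H : Matrix m κ K := Matrix.of fun i k => l (Pi.single i 1) k
  let S : (τ → K) → Matrix κ m K := fun q' => Matrix.of fun k i => eval q' (s k i)
  have hdet : ∀ q', eval q' (Matrix.of fun k k' => ∑ i, s k i * C (H i k')).det =
      (S q' * H).det := by
    intro q'
    rw [RingHom.map_det]
    congr 1
    ext k k'
    simp [Matrix.mul_apply, S]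
  refine ⟨(Matrix.of fun k k' => ∑ i, s k i * C (H i k')).det, ?_, fun q' hq' => ?_⟩
  · have h1 : S q * H = 1 := by
      ext k k'
      have h2 := congrFun (LinearMap.congr_fun hl (Pi.single k 1)) k'
      rw [LinearMap.comp_apply, Fintype.linearCombination_apply_single, one_smul,
        LinearMap.id_apply, pi_eq_sum_univ' (fun i => eval q (s k i)), map_sum] at h2
      simp only [map_smul, Finset.sum_apply, Pi.smul_apply, smul_eq_mul] at h2
      rw [Pi.single_apply] at h2
      simp only [Matrix.mul_apply, Matrix.one_apply, Matrix.of_apply, S, H, eq_comm (a := k)]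
      exact h2
    rw [hdet, h1, Matrix.det_one]
    exact one_ne_zero
  · rw [hdet] at hq'
    rw [Fintype.linearIndependent_iff]
    intro c hc
    have h1 : Matrix.vecMul c (S q') = 0 := by
      rw [← hc]
      ext i
      simp [Matrix.vecMul, dotProduct, S]
    have h2 : Matrix.vecMul c (S q' * H) = 0 := by
      rw [← Matrix.vecMul_vecMul, h1, Matrix.zero_vecMul]
    exact congrFun (Matrix.eq_zero_of_vecMul_eq_zero hq' h2)

variable {K : Type*} [Field K] {n N : ℕ} {B : Set (Line K N)} {X : Set (ℙ K (Vec K N))}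

/-- The substitution of `act q w` into a polynomial, as a polynomial in `q`. -/
def actPoly (w : Vec K N) : MvPolynomial (Fin (N + 1)) K →ₐ[K] MvPolynomial (PlIdx N) K :=
  aeval fun i => ∑ j, MvPolynomial.X (i, j) * C (w j)

theorem eval_actPoly (w : Vec K N) (q : PlIdx N → K) (F : MvPolynomial (Fin (N + 1)) K) :
    eval q (actPoly w F) = eval (act q w) F := by
  rw [actPoly, ← coe_aeval_eq_eval, RingHom.coe_coe, comp_aeval_apply, aeval_eq_eval]
  congr 2
  ext i
  simp [act_apply]

/-- If there is a common tangent space along the general line of `B`, then the tangent spaces at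
smooth points of any line of `B` contain each other. -/
theorem coneTangent_le_of_forGeneral (hB : (idealOf (pluecker '' B)).IsPrime)
    (h : ForGeneral B fun r => ∃ P : Submodule K (Vec K N), Module.finrank K P = n + 2 ∧
      ∀ v ∈ r.1, P ≤ coneTangent X v) {r : Line K N} (hr : r ∈ B) {u v : Vec K N}
    (hu : u ∈ r.1) (hv : v ∈ r.1) (hdim : Module.finrank K (coneTangent X v) = n + 2) :
    coneTangent X v ≤ coneTangent X u := by
  obtain ⟨k, s, hsS, hs, hk⟩ := exists_linearIndependent_orth
    ((fun F i => eval v (pderiv i F)) '' (idealOf X : Set (MvPolynomial (Fin (N + 1)) K)))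
  rw [← coneTangent_eq_orth, hdim, Fintype.card_fin] at hk
  choose F hF hFs using hsS
  intro a ha
  rw [mem_coneTangent]
  intro G hG
  by_cases hspan : (fun i => eval u (pderiv i G)) ∈ Submodule.span K (Set.range s)
  · rw [polyDifferential_apply]
    refine Submodule.span_induction (p := fun s _ => s ⬝ᵥ a = 0) ?_ (zero_dotProduct a)
      (fun y z _ _ hy hz => ?_) (fun c y _ hy => ?_) hspan
    · rintro _ ⟨j, rfl⟩
      rw [← hFs j]
      have h1 := mem_coneTangent.mp ha (F j) (hF j)
      rwa [polyDifferential_apply] at h1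
    · rw [add_dotProduct, hy, hz, add_zero]
    · rw [smul_dotProduct, hy, smul_zero]
  · exfalso
    -- The k gradients at v already cut out a space of dimension n + 2, so one more independent
    -- gradient at u gives k + 1 = N − n of them. Fixing w and w' while q varies moves u and v with
    -- the line, and independence persists for general q. On a line with a common P this gives n + 2
    -- + (k + 1) ≤ N + 1, contrary to n + 2 + k = N + 1.
    have hli := hs.finCons hspan
    obtain ⟨q, hq, hrq⟩ : ∃ (q : PlIdx N → K) (hq : q ≠ 0),
      pluecker r = Projectivization.mk K q hq := ⟨_, wedge_lineBasis_ne_zero r, rfl⟩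
    rw [← range_act hrq] at hu hv
    obtain ⟨w, rfl⟩ := hu
    obtain ⟨w', rfl⟩ := hv
    let F' : Fin (k + 1) → MvPolynomial (Fin (N + 1)) K := Fin.cons G F
    have hF' : ∀ j, F' j ∈ idealOf X := Fin.cases hG hF
    let z : Fin (k + 1) → Vec K N := Fin.cons w fun _ => w'
    have hcons : (fun j i => eval q (actPoly (z j) (pderiv i (F' j)))) =
        (Fin.cons (fun i => eval (act q w) (pderiv i G)) s : Fin (k + 1) → Fin (N + 1) → K) := by
      ext j i
      rw [eval_actPoly]
      refine Fin.cases ?_ (fun j => ?_) j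
      · rfl
      · exact congrFun (hFs j) i
    obtain ⟨D, hD, hDli⟩ := exists_eval_ne_zero_imp_linearIndependent
      (fun j i => actPoly (z j) (pderiv i (F' j))) q (hcons ▸ hli)
    have hDB : D ∉ idealOf (pluecker '' B) := fun hDI =>
      hD (mem_idealOf.mp hDI q ⟨hq, r, hr, hrq⟩)
    obtain ⟨r₁, -, ⟨P, hP, hPle⟩, q₁, hq₁, hrq₁, hD₁⟩ := h.exists_eval_ne_zero hB hDB
    have h1 := finrank_ker_mulVecLin_of_linearIndependent (hDli q₁ hD₁)
    rw [ker_mulVecLin_eq_orth, Fintype.card_fin, Fintype.card_fin] at h1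
    have h2 : P ≤ orth (Set.range fun j i => eval q₁ (actPoly (z j) (pderiv i (F' j)))) := by
      intro b hb
      rw [mem_orth, Set.forall_mem_range]
      intro j
      have h3 := mem_coneTangent.mp (hPle _ (act_mem hrq₁ (z j)) hb) (F' j) (hF' j)
      rw [polyDifferential_apply] at h3
      simp only [eval_actPoly]
      exact h3
    have h3 : n + 2 + (k + 1) ≤ N + 1 :=
      (Nat.add_le_add_right (hP.symm.trans_le (Submodule.finrank_mono h2)) _).trans_eq h1
    omega

theorem constantTangentAlong_of_forGeneral (hB : (idealOf (pluecker '' B)).IsPrime)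
    (hXdim : HasDim X (n + 1))
    (h : ForGeneral B fun r => ∃ P : Submodule K (Vec K N), Module.finrank K P = n + 2 ∧
      ∀ v ∈ r.1, P ≤ coneTangent X v) {r : Line K N} (hr : r ∈ B) : ConstantTangentAlong X r := by
  have hdim : ∀ x, IsNonsingularAt X x → Module.finrank K (coneTangent X x.rep) = n + 2 := by
    intro x hx
    have h1 := hx.2
    rw [hXdim, Nat.cast_inj] at h1
    exact h1
  have hrep : ∀ x : ℙ K (Vec K N), x.submodule ≤ r.1 → x.rep ∈ r.1 := by
    intro x hx
    rwa [Projectivization.submodule_eq, Submodule.span_singleton_le_iff_mem] at hx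
  by_cases hex : ∃ y : ℙ K (Vec K N), y.submodule ≤ r.1 ∧ IsNonsingularAt X y
  · obtain ⟨y, hy, hyns⟩ := hex
    refine ⟨embTangent X y, fun x hx hxns => ?_⟩
    exact Submodule.eq_of_le_of_finrank_eq
      (coneTangent_le_of_forGeneral hB h hr (hrep y hy) (hrep x hx) (hdim x hxns))
      ((hdim x hxns).trans (hdim y hyns).symm)
  -- For a line inside the singular locus the condition is vacuous, and any subspace serves.
  · exact ⟨⊥, fun x hx hxns => absurd ⟨x, hx, hxns⟩ hex⟩

end FocalLines

end

theorem mainTheorem7 {K : Type*} [Field K] [IsAlgClosed K] [CharZero K] {n N : ℕ}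
    (hn : n + 2 ≤ N)
    (B : Set (FocalLines.Line K N))
    (hB : FocalLines.IsProjectiveVariety (FocalLines.pluecker '' B))
    (hBdim : FocalLines.HasDim (FocalLines.pluecker '' B) n)
    (X : Set (ℙ K (FocalLines.Vec K N)))
    (hXB : X = FocalLines.unionOfLines B)
    (hX : FocalLines.IsProjectiveVariety X)
    (hXdim : FocalLines.HasDim X (n + 1)) :
    (FocalLines.ForGeneral B (fun r => FocalLines.HasLength (FocalLines.focalIdeal B r) n) ↔
      ∀ r ∈ B, FocalLines.ConstantTangentAlong X r) ∧
    (FocalLines.ForGeneral B (fun r => FocalLines.HasLength (FocalLines.focalIdeal B r) n) ↔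
      FocalLines.ForGeneral B (fun r => FocalLines.ConstantTangentAlong X r)) := by
  -- The ideal of the empty set is the whole ring, which is not prime.
  have hne : B.Nonempty := by
    rw [Set.nonempty_iff_ne_empty]
    rintro rfl
    refine hB.2.ne_top ((Ideal.eq_top_iff_one _).mpr fun v hv hZ => ?_)
    rw [Set.image_empty] at hZ
    exact hZ.elim
  have hgen := FocalLines.forGeneral_isGeneralLine hB.2 hne hXB hX.2 hBdim hXdim
  have hiff : FocalLines.ForGeneral B
      (fun r => FocalLines.HasLength (FocalLines.focalIdeal B r) n) ↔
      FocalLines.ForGeneral B (fun r => FocalLines.ConstantTangentAlong X r) :=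
    ⟨fun h => (FocalLines.ForGeneral.and hB.2 hgen h).mono fun r hr hr' =>
      (hr'.1.hasLength_iff_constantTangentAlong hn hr hXB hXdim).mp hr'.2,
    fun h => (FocalLines.ForGeneral.and hB.2 hgen h).mono fun r hr hr' =>
      (hr'.1.hasLength_iff_constantTangentAlong hn hr hXB hXdim).mpr hr'.2⟩
  -- What remains is to pass from the general line to every line, by way of the common subspace P on
  -- general lines.
  refine ⟨hiff.trans ⟨fun h r hr => ?_, FocalLines.forGeneral_of_forall hne⟩, hiff⟩
  exact FocalLines.constantTangentAlong_of_forGeneral hB.2 hXdim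
    ((FocalLines.ForGeneral.and hB.2 hgen h).mono fun r hr hr' =>
      (hr'.1.constantTangentAlong_iff hr hXB hXdim).mp hr'.2) hr
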